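/- Let $N\ge 2$ and let $\Omega\subset\mathbb R^N$ be a bounded domain with $C^{1,1}$ boundary $\Gamma=\partial\Omega$. That is, there is a finite system of local coordinates $\{(U_r,y_r,\varphi_r)\}_{r=1}^M$ and $\alpha,\beta>0$ such that the open sets $U_r$ cover $\Gamma$; $y_r=(y_r',y_{rN})$ are rigid (rotated and translated) coordinates of $\mathbb R^N$; with $\Delta=\{y'\in\mathbb R^{N-1}:|y'|<\alpha\}$, the functions $\varphi_r$ are $C^1$ on $\Delta$ with Lipschitz gradient; and $$\Gamma\cap U_r=\{y_r'\in\Delta,\ y_{rN}=\varphi_r(y_r')\},$$ $$\Omega\cap U_r=\{y_r'\in\Delta,\ \varphi_r(y_r')<y_{rN}<\varphi_r(y_r')+\beta\},\qquad \overline\Omega^{\,c}\cap U_r=\{y_r'\in\Delta,\ \varphi_r(y_r')-\beta<y_{rN}<\varphi_r(y_r')\}.$$ For $h>0$ and $\sigma>0$ consider a finite family $\mathcal T_h$ of nondegenerate closed $N$-simplices, any two of which are disjoint or meet in the face spanned by their common vertices, with $h_T:=\operatorname{diam}T\le h$ and $h_T\le\sigma\rho_T$ for all $T\in\mathcal T_h$,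 where $\rho_T$ is the diameter of the largest ball contained in $T$. Put $\overline\Omega_h=\bigcup_{T\in\mathcal T_h}T$, let $\mathcal S_h$ be the set of $(N-1)$-faces $S$ of simplices of $\mathcal T_h$ with $S\subset\partial\overline\Omega_h$, and let $\Gamma_h=\bigcup_{S\in\mathcal S_h}S$. Call $\mathcal T_h$ admissible (for $h$, $\sigma$ and the given local coordinates) if, in addition, all vertices of all $S\in\mathcal S_h$ lie on $\Gamma$ and, for each $r$, $\Gamma_h\cap U_r=\{y_r'\in\Delta,\ y_{rN}=\varphi_{rh}(y_r')\}$ for some continuous function $\varphi_{rh}$ on $\Delta$. Let $d\gamma$, $d\gamma_h$ denote surface measure on $\Gamma$, $\Gamma_h$, and let $\pi$ be the orthogonal (closest-point) projection onto $\Gamma$. **Theorem.** For every $\sigma>0$ there is a constant $C>0$ depending only on $N$, $\Gamma$ and the shape-regularity constant $\sigma$, and, for every system of local coordinates as above, there is $h_0>0$ such that for all $0<h\le h_0$ and all admissible $\mathcal T_h$ every point of $\Gamma_h$ has exactly one closest point on $\Gamma$ (so $\pi$ is well defined on $\Gamma_h$), and the following hold. 1. For every $S\in\mathcal S_h$ and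 every real function $f$ integrable on $\pi(S)$, $f\circ\pi$ is integrable on $S$ and $$\left|\int_{\pi(S)}f\,d\gamma-\int_S f\circ\pi\,d\gamma_h\right|\le Ch^2\int_{\pi(S)}|f|\,d\gamma .$$ 2. For every $f\in L^1(\Gamma)$, $f\circ\pi\in L^1(\Gamma_h)$ and $$\left|\int_{\Gamma}f\,d\gamma-\int_{\Gamma_h}f\circ\pi\,d\gamma_h\right|\le Ch^2\int_{\Gamma}|f|\,d\gamma,\qquad \left|\int_{\Gamma_h}f\circ\pi\,d\gamma_h\right|\le C\int_\Gamma|f|\,d\gamma .$$ 3. For every $p\in[1,\infty]$ and $f\in L^p(\Gamma)$, $f\circ\pi\in L^p(\Gamma_h)$ and $\|f\circ\pi\|_{L^p(\Gamma_h)}\le C^{1/p}\|f\|_{L^p(\Gamma)}$ (with $C^{1/\infty}=1$). -/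

import Mathlib

open MeasureTheory Set
open scoped ENNReal NNReal

noncomputable section

/-- Euclidean space `ℝ^N`. -/
abbrev Euc (N : ℕ) : Type := EuclideanSpace ℝ (Fin N)

/-! ### Domains with `C^{1,1}` boundary -/

/-- A rigid change of coordinates `x ↦ y = (y', y_N)` of `ℝ^N`, with `y' ∈ ℝ^{N-1}` and `y_N ∈ ℝ`
(the target carries the Euclidean norm). -/
abbrev RigidCoord (N : ℕ) : Type := Euc N ≃ᵃⁱ[ℝ] WithLp 2 (Euc (N - 1) × ℝ)

/-- The base set `Δ = {y' ∈ ℝ^{N-1} : |y'| < α}`. -/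
def baseSet (N : ℕ) (α : ℝ) : Set (Euc (N - 1)) := Metric.ball 0 α

/-- The part over `Δ` of the graph `y_N = φ(y')`. -/
def graphSet {N : ℕ} (A : RigidCoord N) (α : ℝ) (φ : Euc (N - 1) → ℝ) : Set (Euc N) :=
  {x | (A x).fst ∈ baseSet N α ∧ (A x).snd = φ (A x).fst}

/-- The points over `Δ` with `φ(y') < y_N < φ(y') + β`. -/
def upperSide {N : ℕ} (A : RigidCoord N) (α β : ℝ) (φ : Euc (N - 1) → ℝ) : Set (Euc N) :=
  {x | (A x).fst ∈ baseSet N α ∧ φ (A x).fst < (A x).snd ∧ (A x).snd < φ (A x).fst + β}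

/-- The points over `Δ` with `φ(y') - β < y_N < φ(y')`. -/
def lowerSide {N : ℕ} (A : RigidCoord N) (α β : ℝ) (φ : Euc (N - 1) → ℝ) : Set (Euc N) :=
  {x | (A x).fst ∈ baseSet N α ∧ φ (A x).fst - β < (A x).snd ∧ (A x).snd < φ (A x).fst}

/-- A finite system of local coordinates `(U_r, y_r, φ_r)` in which the boundary of `Ω` is the graph
of `C^{1,1}` functions `φ_r`, with `Ω` above and the exterior of `Ω` below the graph. -/
structure C11Atlas {N : ℕ} (Ω : Set (Euc N)) where
  /-- number of charts -/
  M : ℕ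
  α : ℝ
  β : ℝ
  α_pos : 0 < α
  β_pos : 0 < β
  U : Fin M → Set (Euc N)
  coord : Fin M → RigidCoord N
  φ : Fin M → Euc (N - 1) → ℝ
  isOpen_U : ∀ r, IsOpen (U r)
  cover : frontier Ω ⊆ ⋃ r, U r
  contDiffOn : ∀ r, ContDiffOn ℝ 1 (φ r) (baseSet N α)
  lipschitz_fderiv : ∀ r, ∃ L : ℝ≥0, LipschitzOnWith L (fderiv ℝ (φ r)) (baseSet N α)
  frontier_eq : ∀ r, frontier Ω ∩ U r = graphSet (coord r) α (φ r)
  inside_eq : ∀ r, Ω ∩ U r = upperSide (coord r) α β (φ r)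
  outside_eq : ∀ r, (closure Ω)ᶜ ∩ U r = lowerSide (coord r) α β (φ r)

/-- Bounded domains (nonempty connected open sets) of `ℝ^N` with `C^{1,1}` boundary. -/
structure IsC11Domain {N : ℕ} (Ω : Set (Euc N)) : Prop where
  isOpen : IsOpen Ω
  isConnected : IsConnected Ω
  isBounded : Bornology.IsBounded Ω
  exists_atlas : Nonempty (C11Atlas Ω)

/-! ### Triangulations -/

/-- The closed simplex spanned by a finite set of vertices. -/
def simplexHull {N : ℕ} (s : Finset (Euc N)) : Set (Euc N) := convexHull ℝ (s : Set (Euc N))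

/-- A finite conforming family of nondegenerate closed `N`-simplices in `ℝ^N`, each given by its set
of `N + 1` vertices: two of them meet in the face spanned by their common vertices (which is empty
if there are none). -/
structure Triangulation (N : ℕ) where
  cells : Finset (Finset (Euc N))
  card_eq : ∀ T ∈ cells, T.card = N + 1
  affineIndependent : ∀ T ∈ cells, AffineIndependent ℝ (fun v : T => (v : Euc N))
  conforming : ∀ T ∈ cells, ∀ T' ∈ cells,
    simplexHull T ∩ simplexHull T' = convexHull ℝ ((T : Set (Euc N)) ∩ (T' : Set (Euc N)))

/-- The closed polyhedral set `⋃ T`, that is, the closure of `Ω_h`. -/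
def Triangulation.carrier {N : ℕ} (𝒯 : Triangulation N) : Set (Euc N) :=
  ⋃ T ∈ 𝒯.cells, simplexHull T

/-- The boundary mesh: the `(N-1)`-faces of the simplices (given by their `N` vertices) that lie in
the boundary of the polyhedral set. -/
def Triangulation.boundaryMesh {N : ℕ} (𝒯 : Triangulation N) : Set (Finset (Euc N)) :=
  {S | S.card = N ∧ (∃ T ∈ 𝒯.cells, S ⊆ T) ∧ simplexHull S ⊆ frontier 𝒯.carrier}

/-- The discrete boundary `Γ_h = ⋃ S`, the union of the boundary mesh. -/
def Triangulation.boundary {N : ℕ} (𝒯 : Triangulation N) : Set (Euc N) :=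
  ⋃ S ∈ 𝒯.boundaryMesh, simplexHull S

/-- The diameter of the largest ball contained in `K`. -/
def inscribedDiam {N : ℕ} (K : Set (Euc N)) : ℝ :=
  sSup {ρ : ℝ | 0 ≤ ρ ∧ ∃ c, Metric.closedBall c (ρ / 2) ⊆ K}

/-- `𝒯` is a triangulation of mesh size `h` and shape regularity constant `σ` whose boundary
approximates the boundary of `Ω` and is compatible with the local coordinates `𝒜`. -/
structure IsAdmissible {N : ℕ} {Ω : Set (Euc N)} (𝒜 : C11Atlas Ω) (σ h : ℝ)
    (𝒯 : Triangulation N) : Prop where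
  diam_le : ∀ T ∈ 𝒯.cells, Metric.diam (simplexHull T) ≤ h
  shape_regular : ∀ T ∈ 𝒯.cells,
    Metric.diam (simplexHull T) ≤ σ * inscribedDiam (simplexHull T)
  vertices_mem : ∀ S ∈ 𝒯.boundaryMesh, ∀ v ∈ S, v ∈ frontier Ω
  graph : ∀ r, ∃ φh : Euc (N - 1) → ℝ, ContinuousOn φh (baseSet N 𝒜.α) ∧
    𝒯.boundary ∩ 𝒜.U r = graphSet (𝒜.coord r) 𝒜.α φh

/-! ### Projection and surface measure -/

/-- `p` is a closest point of `Γ` to `x`. -/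
def IsClosestPoint {N : ℕ} (Γ : Set (Euc N)) (x p : Euc N) : Prop :=
  p ∈ Γ ∧ dist x p = Metric.infDist x Γ

/-- The orthogonal projection `π` onto `Γ`: the closest point (unique near a `C^{1,1}` surface). -/
def surfaceProj {N : ℕ} (Γ : Set (Euc N)) (x : Euc N) : Euc N :=
  Classical.epsilon (IsClosestPoint Γ x)

/-- Surface measure on hypersurfaces of `ℝ^N`: the `(N-1)`-dimensional Hausdorff measure,
normalized so as to agree with Lebesgue measure on `ℝ^{N-1}`. -/
def surfaceMeasure (N : ℕ) : Measure (Euc N) := Measure.euclideanHausdorffMeasure (N - 1)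

end

/-! ### Comparable measures -/

section Comparison

variable {α : Type*} [MeasurableSpace α] {μ ν : Measure α} {δ : ℝ}

/-! The projection `π` is handled as a map that nearly preserves distances, with no Jacobian and no
derivative of the distance function. On a single face it is bi-Lipschitz with both constants `1 +
O(h²)`; since `(N-1)`-dimensional Hausdorff measure scales with the power `N-1` of a Lipschitz
constant, surface measure changes by a factor `1 + O(h²)`, and the integral estimates are
comparisons of image measures.

The bi-Lipschitz bound rests on two facts about a face with vertices on `Γ`: its points lie at
distance `O(h²)` from `Γ`, and, by shape regularity, it is orthogonal to the normal up to `O(h)`.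
Let `x, y` lie in the face with closest points `p, q`, and write `x - p = s m(p)`, `y - q = t m(q)`
with a Lipschitz normal field `m`. Then `x - y = (p - q) + n` with `n = s m(p) - t m(q)`. The cross
term `⟨p - q, n⟩` is `O(h²)|p - q|²`, because `Γ` leaves its tangent planes quadratically and `s, t
= O(h²)`. Moreover `|n| = O(h)(|x - y| + |p - q|)`, so it enters only squared
(`IsNormalPatch.abs_sq_sub_sq_le`).

For the whole boundary, `π : Γ_h → Γ` must also be bijective. It is onto because a normal segment
through `p` crosses the graph of `φ_h`, by the intermediate value theorem
(`exists_mem_boundary_isClosestPoint`). It is one-to-one because two points over the same `p` differ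
by a multiple of `m(p)`, whereas a path on `Γ_h` joining them stays on faces almost orthogonal to
`m(p)` (`eq_of_isClosestPoint`). Only bijectivity uses the graph property in the prescribed atlas,
and it affects `h₀` but not `C`. -/

theorem integral_le_of_le_smul_measure (hδ : 0 ≤ δ) (h : ν ≤ ENNReal.ofReal (1 + δ) • μ)
    {g : α → ℝ} (hg : Integrable g μ) (hg0 : ∀ x, 0 ≤ g x) :
    ∫ x, g x ∂ν ≤ (1 + δ) * ∫ x, g x ∂μ := by
  have h1 : Integrable g (ENNReal.ofReal (1 + δ) • μ) := hg.smul_measure ENNReal.ofReal_ne_top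
  calc ∫ x, g x ∂ν ≤ ∫ x, g x ∂(ENNReal.ofReal (1 + δ) • μ) :=
        integral_mono_measure h (Filter.Eventually.of_forall hg0) h1
    _ = (1 + δ) * ∫ x, g x ∂μ := by
        rw [integral_smul_measure, ENNReal.toReal_ofReal (by linarith), smul_eq_mul]

theorem integrable_of_le_smul_measure (h : ν ≤ ENNReal.ofReal (1 + δ) • μ)
    {g : α → ℝ} (hg : Integrable g μ) : Integrable g ν :=
  (hg.smul_measure ENNReal.ofReal_ne_top).mono_measure h

/-- For `g ≥ 0` the integrals over `μ` and `ν` differ by a factor of at most `1 + δ` either way,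
hence by at most `δ ∫ g dμ`; the factor 2 is slack. The bounds for the positive and negative parts
of `f` add up to the integral of `|f|`. -/
theorem abs_integral_sub_integral_le_of_comparable (hδ : 0 ≤ δ)
    (h₁ : ν ≤ ENNReal.ofReal (1 + δ) • μ) (h₂ : μ ≤ ENNReal.ofReal (1 + δ) • ν)
    {f : α → ℝ} (hf : Integrable f μ) :
    |(∫ x, f x ∂μ) - ∫ x, f x ∂ν| ≤ 2 * δ * ∫ x, |f x| ∂μ := by
  have key : ∀ g : α → ℝ, Integrable g μ → (∀ x, 0 ≤ g x) →
      |(∫ x, g x ∂μ) - ∫ x, g x ∂ν| ≤ 2 * δ * ∫ x, g x ∂μ := by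
    intro g hg hg0
    have a1 := integral_le_of_le_smul_measure hδ h₁ hg hg0
    have a2 := integral_le_of_le_smul_measure hδ h₂ (integrable_of_le_smul_measure h₁ hg) hg0
    have a3 : 0 ≤ ∫ x, g x ∂μ := integral_nonneg hg0
    rw [abs_le]
    constructor <;> nlinarith [mul_nonneg hδ a3, mul_nonneg hδ (mul_nonneg hδ a3)]
  have i1 : Integrable (fun x => max (f x) 0) μ := hf.pos_part
  have i2 : Integrable (fun x => max (-f x) 0) μ := hf.neg_part
  have k1 := key _ i1 (fun x => le_max_right _ _)
  have k2 := key _ i2 (fun x => le_max_right _ _)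
  have e1 : ∀ x, f x = max (f x) 0 - max (-f x) 0 := fun x => by
    rcases le_total 0 (f x) with h | h
    · rw [max_eq_left h, max_eq_right (by linarith)]; ring
    · rw [max_eq_right h, max_eq_left (by linarith)]; ring
  have e2 : ∀ x, |f x| = max (f x) 0 + max (-f x) 0 := fun x => by
    rcases le_total 0 (f x) with h | h
    · rw [max_eq_left h, max_eq_right (by linarith), abs_of_nonneg h]; ring
    · rw [max_eq_right h, max_eq_left (by linarith), abs_of_nonpos h]; ring
  have s1 : ∫ x, f x ∂μ = (∫ x, max (f x) 0 ∂μ) - ∫ x, max (-f x) 0 ∂μ := by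
    rw [← integral_sub i1 i2]; exact integral_congr_ae (Filter.Eventually.of_forall e1)
  have s2 : ∫ x, f x ∂ν = (∫ x, max (f x) 0 ∂ν) - ∫ x, max (-f x) 0 ∂ν := by
    rw [← integral_sub (integrable_of_le_smul_measure h₁ i1)
      (integrable_of_le_smul_measure h₁ i2)]
    exact integral_congr_ae (Filter.Eventually.of_forall e1)
  have s3 : ∫ x, |f x| ∂μ = (∫ x, max (f x) 0 ∂μ) + ∫ x, max (-f x) 0 ∂μ := by
    rw [← integral_add i1 i2]; exact integral_congr_ae (Filter.Eventually.of_forall e2)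
  rw [s1, s2, s3]
  rw [abs_le] at *
  constructor <;> linarith [k1.1, k1.2, k2.1, k2.2]

end Comparison

/-! ### Maps that almost preserve a measure -/

/-- `g` is continuous and injective on `Z`, and it changes the `μ`-measure of measurable subsets of
`Z` at most by the factor `1 + δ`. -/
structure AlmostMeasurePreservingOn {X : Type*} [TopologicalSpace X] [MeasurableSpace X]
    (μ : Measure X) (δ : ℝ) (g : X → X) (Z : Set X) : Prop where
  measurableSet : MeasurableSet Z
  continuousOn : ContinuousOn g Z
  injOn : InjOn g Z
  image_le : ∀ E ⊆ Z, MeasurableSet E → μ (g '' E) ≤ ENNReal.ofReal (1 + δ) * μ E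
  le_image : ∀ E ⊆ Z, MeasurableSet E → μ E ≤ ENNReal.ofReal (1 + δ) * μ (g '' E)

namespace AlmostMeasurePreservingOn

variable {X : Type*} [TopologicalSpace X] [MeasurableSpace X] [BorelSpace X]
  {μ : Measure X} {δ : ℝ} {g : X → X} {Z : Set X}

theorem measurableSet_preimage_inter (h : AlmostMeasurePreservingOn μ δ g Z) {B : Set X}
    (hB : MeasurableSet B) : MeasurableSet (g ⁻¹' B ∩ Z) := by
  have h1 : Measurable (Z.domRestrict g) := (continuousOn_iff_continuous_domRestrict.1 h.continuousOn).measurable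
  have h2 := h.measurableSet.subtype_image (h1 hB)
  convert h2 using 1
  ext x
  simp [and_comm, domRestrict]

theorem aemeasurable (h : AlmostMeasurePreservingOn μ δ g Z) : AEMeasurable g (μ.restrict Z) :=
  h.continuousOn.aemeasurable h.measurableSet

/-- Since `g (g⁻¹ B ∩ Z) = B ∩ g Z`, the setwise bounds on `g` become a comparison of the image
measure with the restricted measure. -/
theorem map_le (h : AlmostMeasurePreservingOn μ δ g Z) :
    (μ.restrict Z).map g ≤ ENNReal.ofReal (1 + δ) • μ.restrict (g '' Z) := by
  refine Measure.le_iff.2 fun B hB => ?_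
  rw [Measure.map_apply_of_aemeasurable h.aemeasurable hB, Measure.restrict_apply' h.measurableSet,
    Measure.smul_apply, smul_eq_mul, Measure.restrict_apply hB, ← image_preimage_inter]
  exact h.le_image _ inter_subset_right (h.measurableSet_preimage_inter hB)

theorem le_map (h : AlmostMeasurePreservingOn μ δ g Z) :
    μ.restrict (g '' Z) ≤ ENNReal.ofReal (1 + δ) • (μ.restrict Z).map g := by
  refine Measure.le_iff.2 fun B hB => ?_
  rw [Measure.smul_apply, smul_eq_mul,
    Measure.map_apply_of_aemeasurable h.aemeasurable hB, Measure.restrict_apply' h.measurableSet,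
    Measure.restrict_apply hB, ← image_preimage_inter]
  exact h.image_le _ inter_subset_right (h.measurableSet_preimage_inter hB)

theorem integral_estimates (h : AlmostMeasurePreservingOn μ δ g Z) (hδ : 0 ≤ δ)
    {f : X → ℝ} (hf : IntegrableOn f (g '' Z) μ) :
    IntegrableOn (f ∘ g) Z μ ∧
      |(∫ x in g '' Z, f x ∂μ) - ∫ x in Z, f (g x) ∂μ| ≤ 2 * δ * ∫ x in g '' Z, |f x| ∂μ ∧
      |∫ x in Z, f (g x) ∂μ| ≤ (1 + δ) * ∫ x in g '' Z, |f x| ∂μ := by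
  have hν : Integrable f ((μ.restrict Z).map g) := integrable_of_le_smul_measure h.map_le hf
  have e : ∫ x in Z, f (g x) ∂μ = ∫ x, f x ∂((μ.restrict Z).map g) :=
    (integral_map h.aemeasurable hν.1).symm
  refine ⟨(integrable_map_measure hν.1 h.aemeasurable).1 hν, ?_, ?_⟩
  · rw [e]
    exact abs_integral_sub_integral_le_of_comparable hδ h.map_le h.le_map hf
  · rw [e]
    exact (abs_integral_le_integral_abs).trans
      (integral_le_of_le_smul_measure hδ h.map_le hf.abs fun x => abs_nonneg _)

theorem memLp_comp (h : AlmostMeasurePreservingOn μ δ g Z) (hδ : 0 ≤ δ) {p : ℝ≥0∞}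
    {f : X → ℝ} (hf : MemLp f p (μ.restrict (g '' Z))) :
    MemLp (f ∘ g) p (μ.restrict Z) ∧
      eLpNorm (f ∘ g) p (μ.restrict Z) ≤
        ENNReal.ofReal (1 + δ) ^ (1 / p).toReal * eLpNorm f p (μ.restrict (g '' Z)) := by
  have hν : AEStronglyMeasurable f ((μ.restrict Z).map g) :=
    (hf.1.smul_measure _).mono_measure h.map_le
  have hle : eLpNorm (f ∘ g) p (μ.restrict Z) ≤
      ENNReal.ofReal (1 + δ) ^ (1 / p).toReal * eLpNorm f p (μ.restrict (g '' Z)) := by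
    -- Scaling a measure by `c` scales the `L^p` seminorm by `c^(1/p)`; for `p = ∞` the exponent is
    -- 0.
    rw [← eLpNorm_map_measure hν h.aemeasurable, ← smul_eq_mul,
      ← eLpNorm_smul_measure_of_ne_zero (by simp; linarith)]
    exact eLpNorm_mono_measure _ h.map_le
  refine ⟨⟨hν.comp_aemeasurable h.aemeasurable, hle.trans_lt ?_⟩, hle⟩
  exact ENNReal.mul_lt_top (ENNReal.rpow_lt_top_of_nonneg ENNReal.toReal_nonneg
    ENNReal.ofReal_ne_top) hf.2

/-- A continuous injective map on a finite union of closed pieces, almost measure preserving on each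
of them, is almost measure preserving. -/
theorem biUnion {Y : Type*} [TopologicalSpace Y] [PolishSpace Y] [MeasurableSpace Y]
    [BorelSpace Y] {μ : Measure Y} {g : Y → Y} {ι : Type*} {I : Set ι} (hI : I.Finite)
    {S : ι → Set Y} (hS : ∀ i ∈ I, IsClosed (S i))
    (h : ∀ i ∈ I, AlmostMeasurePreservingOn μ δ g (S i)) (hinj : InjOn g (⋃ i ∈ I, S i)) :
    AlmostMeasurePreservingOn μ δ g (⋃ i ∈ I, S i) := by
  have hcl : ∀ J : Set ι, J.Finite → J ⊆ I → ContinuousOn g (⋃ i ∈ J, S i) := by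
    intro J hJ
    induction J, hJ using Set.Finite.induction_on with
    | empty => intro _; simp
    | @insert a s _ hs ih =>
      intro hsub
      rw [biUnion_insert]
      refine ContinuousOn.union_of_isClosed (h a (hsub (mem_insert _ _))).continuousOn
        (ih ((subset_insert _ _).trans hsub)) (hS a (hsub (mem_insert _ _)))
        (hs.isClosed_biUnion fun i hi => hS i (hsub (mem_insert_of_mem _ hi)))
  have key : ∀ J : Set ι, J.Finite → J ⊆ I → ∀ E ⊆ ⋃ i ∈ J, S i, MeasurableSet E →
      μ (g '' E) ≤ ENNReal.ofReal (1 + δ) * μ E ∧ μ E ≤ ENNReal.ofReal (1 + δ) * μ (g '' E) := by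
    intro J hJ
    induction J, hJ using Set.Finite.induction_on with
    | empty =>
      intro _ E hE _
      have : E = ∅ := by simpa using hE
      simp [this]
    | @insert a s _ hs ih =>
      intro hsub E hE hEm
      have ha := hsub (mem_insert a s)
      have hsI : s ⊆ I := (subset_insert _ _).trans hsub
      -- The pieces may overlap. Giving `E ∩ S a` to one piece and `E \ S a` to the others makes it
      -- unnecessary to know that overlaps are null.
      have m1 : MeasurableSet (E ∩ S a) := hEm.inter (hS a ha).measurableSet
      have m2 : MeasurableSet (E \ S a) := hEm.diff (hS a ha).measurableSet
      have hd : E \ S a ⊆ ⋃ i ∈ s, S i := by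
        intro x hx
        have := hE hx.1
        rw [biUnion_insert] at this
        exact this.resolve_left hx.2
      obtain ⟨k1, k2⟩ := ih hsI _ hd m2
      have j1 := (h a ha).image_le _ inter_subset_right m1
      have j2 := (h a ha).le_image _ inter_subset_right m1
      have hEu : E ⊆ ⋃ i ∈ I, S i := hE.trans (biUnion_subset_biUnion_left hsub)
      have hμ : μ E = μ (E ∩ S a) + μ (E \ S a) := (measure_inter_add_sdiff E (hS a ha).measurableSet).symm
      have him : μ (g '' E) = μ (g '' (E ∩ S a)) + μ (g '' (E \ S a)) := by
        conv_lhs => rw [← inter_union_sdiff E (S a), image_union]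
        refine measure_union ?_ ?_
        · refine (hinj.image_inter (inter_subset_left.trans hEu) (sdiff_subset.trans hEu)).symm.trans ?_
            |> disjoint_iff_inter_eq_empty.2
          rw [show E ∩ S a ∩ (E \ S a) = ∅ by ext x; simp; tauto, image_empty]
        -- Lusin–Souslin: in a Polish space the continuous injective image of a Borel set is Borel.
        · exact m2.image_of_continuousOn_injOn ((hcl I hI Subset.rfl).mono (sdiff_subset.trans hEu))
            (hinj.mono (sdiff_subset.trans hEu))
      rw [hμ, him, mul_add, mul_add]
      exact ⟨add_le_add j1 k1, add_le_add j2 k2⟩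
  exact ⟨(hI.isClosed_biUnion hS).measurableSet, hcl I hI Subset.rfl, hinj,
    fun E hE hm => (key I hI Subset.rfl E hE hm).1, fun E hE hm => (key I hI Subset.rfl E hE hm).2⟩

end AlmostMeasurePreservingOn

theorem one_add_pow_le_of_le_one {u : ℝ} (h0 : 0 ≤ u) (h1 : u ≤ 1) (n : ℕ) :
    (1 + u) ^ n ≤ 1 + 2 ^ n * u := by
  -- The chord of the convex function `(1 + u) ^ n` over `[0, 1]`; this sharper form is the one that
  -- passes through the induction.
  have key : (1 + u) ^ n ≤ 1 + (2 ^ n - 1) * u := by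
    induction n with
    | zero => simp
    | succ n ih =>
      have h2 : (1 : ℝ) ≤ 2 ^ n := one_le_pow₀ (by norm_num)
      calc (1 + u) ^ (n + 1) = (1 + u) ^ n * (1 + u) := pow_succ _ _
        _ ≤ (1 + (2 ^ n - 1) * u) * (1 + u) := by gcongr
        _ ≤ 1 + (2 ^ (n + 1) - 1) * u := by
          rw [pow_succ]
          have : (0 : ℝ) ≤ (2 ^ n - 1) * u := mul_nonneg (by linarith) h0
          nlinarith [mul_nonneg this (by linarith : 0 ≤ 1 - u)]
  linarith

theorem surfaceMeasure_image_le {N : ℕ} {E : Set (Euc N)} {g : Euc N → Euc N} {ε : ℝ}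
    (h0 : 0 ≤ ε) (h1 : ε ≤ 1)
    (hg : ∀ x ∈ E, ∀ y ∈ E, dist (g x) (g y) ≤ (1 + ε) * dist x y) :
    surfaceMeasure N (g '' E) ≤ ENNReal.ofReal (1 + 2 ^ (N - 1) * ε) * surfaceMeasure N E := by
  have hK : LipschitzOnWith (1 + ε).toNNReal g E := LipschitzOnWith.of_dist_le_mul fun x hx y hy => by
    rw [Real.coe_toNNReal _ (by linarith)]; exact hg x hx y hy
  have h2 := hK.hausdorffMeasure_image_le (d := ((N - 1 : ℕ) : ℝ)) (Nat.cast_nonneg _)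
  have h3 : ENNReal.ofReal (1 + ε) ^ ((N - 1 : ℕ) : ℝ) ≤
      ENNReal.ofReal (1 + 2 ^ (N - 1) * ε) := by
    rw [ENNReal.rpow_natCast, ← ENNReal.ofReal_pow (by linarith)]
    exact ENNReal.ofReal_le_ofReal (one_add_pow_le_of_le_one h0 h1 _)
  rw [surfaceMeasure, Measure.euclideanHausdorffMeasure_def, Measure.smul_apply, Measure.smul_apply,
    ENNReal.smul_def, ENNReal.smul_def, smul_eq_mul, smul_eq_mul, mul_left_comm]
  gcongr
  exact h2.trans (mul_le_mul_left h3 _)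

/-- A map that is bi-Lipschitz with constants `1 + ε` almost preserves surface measure. -/
theorem almostMeasurePreservingOn_of_biLipschitz {N : ℕ} {Z : Set (Euc N)} (hZ : MeasurableSet Z)
    {g : Euc N → Euc N} {ε : ℝ} (h0 : 0 ≤ ε) (h1 : ε ≤ 1)
    (hup : ∀ x ∈ Z, ∀ y ∈ Z, dist (g x) (g y) ≤ (1 + ε) * dist x y)
    (hlow : ∀ x ∈ Z, ∀ y ∈ Z, dist x y ≤ (1 + ε) * dist (g x) (g y)) :
    AlmostMeasurePreservingOn (surfaceMeasure N) (2 ^ (N - 1) * ε) g Z := by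
  have hinj : InjOn g Z := fun x hx y hy hxy => by
    have := hlow x hx y hy
    rw [hxy, dist_self, mul_zero] at this
    exact dist_le_zero.1 this
  have hK : LipschitzOnWith (1 + ε).toNNReal g Z := LipschitzOnWith.of_dist_le_mul fun x hx y hy => by
    rw [Real.coe_toNNReal _ (by linarith)]; exact hup x hx y hy
  refine ⟨hZ, hK.continuousOn, hinj, fun E hE _ => ?_, fun E hE _ => ?_⟩
  · exact surfaceMeasure_image_le h0 h1 fun x hx y hy => hup x (hE hx) y (hE hy)
  -- The reverse inequality is the Lipschitz bound for the inverse map on `g '' E`.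
  · have hleft : ∀ x ∈ E, Function.invFunOn g E (g x) = x :=
      fun x hx => (hinj.mono hE).leftInvOn_invFunOn hx
    have him : Function.invFunOn g E '' (g '' E) = E :=
      (hinj.mono hE).invFunOn_image Subset.rfl
    have := surfaceMeasure_image_le (E := g '' E) (g := Function.invFunOn g E) h0 h1 (by
      rintro _ ⟨x, hx, rfl⟩ _ ⟨y, hy, rfl⟩
      rw [hleft x hx, hleft y hy]
      exact hlow x (hE hx) y (hE hy))
    rwa [him] at this

/-! ### Two elementary facts on functions of one variable and on simplices -/

/-- A continuous function on `[0, 1]` that is `κ`-Lipschitz on each of finitely many closed sets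
covering `[0, 1]` changes by at most `κ`. -/
theorem abs_sub_le_of_finite_closed_cover {ι : Type*} {I : Set ι} (hI : I.Finite) {F : ι → Set ℝ}
    (hF : ∀ i ∈ I, IsClosed (F i)) (hcov : Icc (0 : ℝ) 1 ⊆ ⋃ i ∈ I, F i) {g : ℝ → ℝ}
    (hg : ContinuousOn g (Icc 0 1)) {κ : ℝ}
    (hκ : ∀ i ∈ I, ∀ s ∈ F i ∩ Icc 0 1, ∀ t ∈ F i ∩ Icc 0 1, |g s - g t| ≤ κ * |s - t|) :
    |g 1 - g 0| ≤ κ := by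
  have hcl : IsClosed ({t | |g t - g 0| - κ * t ≤ 0} ∩ Icc (0 : ℝ) 1) := by
    rw [inter_comm]
    have hc : ContinuousOn (fun t => |g t - g 0| - κ * t) (Icc (0 : ℝ) 1) :=
      ((hg.sub continuousOn_const).abs).sub (continuousOn_const.mul continuousOn_id)
    exact hc.preimage_isClosed_of_isClosed isClosed_Icc isClosed_Iic
  have := hcl.Icc_subset_of_forall_mem_nhdsWithin (by simp) (fun t ht => ?_) (right_mem_Icc.2 zero_le_one)
  · simpa using this
  obtain ⟨ht, ht0, ht1⟩ := ht
  -- The finitely many closed sets that miss `t` also miss a neighbourhood of `t`, so every nearby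
  -- `s` shares with `t` each piece containing `s`. This lets the bound `|g t - g 0| ≤ κ t`
  -- propagate to the right.
  have h1 : ∀ᶠ s in nhds t, ∀ i ∈ I, s ∈ F i → t ∈ F i := by
    rw [Filter.eventually_all_finite hI]
    intro i hi
    by_cases h : t ∈ F i
    · exact Filter.Eventually.of_forall fun _ _ => h
    · filter_upwards [(hF i hi).isOpen_compl.mem_nhds h] with s hs hs'
      exact absurd hs' hs
  have h2 : ∀ᶠ s in nhdsWithin t (Ioi t), s ∈ Ioo t 1 := Ioo_mem_nhdsGT ht1
  filter_upwards [h1.filter_mono nhdsWithin_le_nhds, h2] with s hs hs2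
  have hs01 : s ∈ Icc (0 : ℝ) 1 := ⟨ht0.trans hs2.1.le, hs2.2.le⟩
  obtain ⟨i, hi, hsi⟩ := mem_iUnion₂.1 (hcov hs01)
  have h3 := hκ i hi s ⟨hsi, hs01⟩ t ⟨hs i hi hsi, ht0, ht1.le⟩
  rw [abs_of_pos (sub_pos.2 hs2.1)] at h3
  have h4 := abs_sub_le (g s) (g t) (g 0)
  simp only [mem_ofPred_eq] at ht ⊢
  nlinarith

/-- On a face of a simplex that contains a ball of radius `r`, a linear function whose differences
to a fixed vertex value are at most `b` at the vertices is Lipschitz. -/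
theorem abs_map_sub_le_of_simplex {N : ℕ} {T S : Finset (Euc N)} (hcard : T.card = N + 1)
    (haff : AffineIndependent ℝ (fun v : T => (v : Euc N))) (hST : S ⊆ T) {c : Euc N} {r : ℝ}
    (hr : 0 < r) (hball : Metric.closedBall c r ⊆ simplexHull T) (l : Euc N →ₗ[ℝ] ℝ)
    {v₀ : Euc N} {b : ℝ} (hb : ∀ v ∈ S, |l (v - v₀)| ≤ b) {x y : Euc N}
    (hx : x ∈ simplexHull S) (hy : y ∈ simplexHull S) :
    |l (x - y)| ≤ S.card * b * (‖x - y‖ / (2 * r)) := by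
  have htop : affineSpan ℝ (range (fun v : T => (v : Euc N))) = ⊤ := by
    rw [haff.affineSpan_eq_top_iff_card_eq_finrank_add_one]
    simp [hcard]
  let B : AffineBasis T ℝ (Euc N) := ⟨fun v => v, haff, htop⟩
  have hT : ∀ i : T, ∀ z ∈ simplexHull T, B.coord i z ∈ Icc (0 : ℝ) 1 := by
    intro i z hz
    have : simplexHull T ⊆ (B.coord i) ⁻¹' Icc (0 : ℝ) 1 := by
      refine convexHull_min (fun v hv => ?_) ((convex_Icc 0 1).affine_preimage _)
      have e : v = B ⟨v, hv⟩ := rfl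
      rw [mem_preimage, e, B.coord_apply]
      split_ifs <;> simp
    exact this hz
  have hS : ∀ i : T, (i : Euc N) ∉ S → ∀ z ∈ simplexHull S, B.coord i z = 0 := by
    intro i hi z hz
    have : simplexHull S ⊆ (B.coord i) ⁻¹' {0} := by
      refine convexHull_min (fun v hv => ?_) ((convex_singleton 0).affine_preimage _)
      have e : v = B ⟨v, hST hv⟩ := rfl
      rw [mem_preimage, e, B.coord_apply_ne, mem_singleton_iff]
      rintro rfl
      exact hi hv
    exact this hz
  -- A barycentric coordinate is affine with values in `[0, 1]` on the ball, so along a diameter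
  -- parallel to `x - y` it varies by at most 1 over a length `2r`.
  have hcoord : ∀ i : T, |B.coord i x - B.coord i y| ≤ ‖x - y‖ / (2 * r) := by
    intro i
    by_cases hxy : x = y
    · simp [hxy]
    have hn : 0 < ‖x - y‖ := norm_pos_iff.2 (sub_ne_zero.2 hxy)
    set u := (r / ‖x - y‖) • (x - y) with hu
    have hnu : ‖u‖ = r := by
      rw [hu, norm_smul, Real.norm_of_nonneg (by positivity)]; field_simp
    have h1 := hT i (c + u) (hball (by simp [hnu]))
    have h2 := hT i (c - u) (hball (by simp [hnu]))
    have h3 : B.coord i (c + u) - B.coord i (c - u) =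
        (2 * r / ‖x - y‖) * (B.coord i x - B.coord i y) := by
      have e1 := (B.coord i).linearMap_vsub (c + u) (c - u)
      have e2 := (B.coord i).linearMap_vsub x y
      simp only [vsub_eq_sub] at e1 e2
      rw [← e1, ← e2, show c + u - (c - u) = (2 * r / ‖x - y‖) • (x - y) by rw [hu]; module,
        map_smul, smul_eq_mul]
    have h4 : |(2 * r / ‖x - y‖) * (B.coord i x - B.coord i y)| ≤ 1 := by
      rw [← h3, abs_le]; constructor <;> linarith [h1.1, h1.2, h2.1, h2.2]
    rw [abs_mul, abs_of_pos (by positivity)] at h4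
    rw [le_div_iff₀ (by positivity)]
    rw [div_mul_eq_mul_div, div_le_one hn] at h4
    linarith
  -- The differences of the barycentric coordinates sum to 0, which allows `v₀` to be subtracted
  -- from every vertex.
  have hsum : l (x - y) = ∑ i : T, (B.coord i x - B.coord i y) * l (i - v₀) := by
    have e1 := B.linear_combination_coord_eq_self x
    have e2 := B.linear_combination_coord_eq_self y
    have e3 : ∑ i, (B.coord i x - B.coord i y) = 0 := by
      rw [Finset.sum_sub_distrib, B.sum_coord_apply_eq_one, B.sum_coord_apply_eq_one, sub_self]
    have e4 : x - y = ∑ i : T, (B.coord i x - B.coord i y) • ((i : Euc N) - v₀) := by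
      simp_rw [smul_sub]
      rw [Finset.sum_sub_distrib, ← Finset.sum_smul, e3, zero_smul, sub_zero]
      simp_rw [sub_smul]
      rw [Finset.sum_sub_distrib]
      exact (congrArg₂ (· - ·) e1 e2).symm
    rw [e4, map_sum]
    simp
  have hb0 : ∀ i : T, |(B.coord i x - B.coord i y) * l (i - v₀)| ≤
      if (i : Euc N) ∈ S then b * (‖x - y‖ / (2 * r)) else 0 := by
    intro i
    split_ifs with h
    · rw [abs_mul, mul_comm]
      exact mul_le_mul (hb _ h) (hcoord i) (abs_nonneg _) ((abs_nonneg _).trans (hb _ h))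
    · rw [hS i h x hx, hS i h y hy]; simp
  calc |l (x - y)| ≤ ∑ i : T, |(B.coord i x - B.coord i y) * l (i - v₀)| := by
        rw [hsum]; exact Finset.abs_sum_le_sum_abs _ _
    _ ≤ ∑ i : T, if (i : Euc N) ∈ S then b * (‖x - y‖ / (2 * r)) else 0 :=
        Finset.sum_le_sum fun i _ => hb0 i
    _ = S.card * b * (‖x - y‖ / (2 * r)) := by
        rw [Finset.sum_coe_sort T (fun v => if v ∈ S then b * (‖x - y‖ / (2 * r)) else 0),
          Finset.sum_ite_mem, Finset.inter_eq_right.2 hST, Finset.sum_const, nsmul_eq_mul]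
        ring

/-! ### Closest points on a surface with a Lipschitz normal field -/

section ClosestPoint

variable {N : ℕ} {Γ D : Set (Euc N)} {m : Euc N → Euc N} {L : ℝ}

theorem exists_isClosestPoint (hΓ : IsClosed Γ) (hne : Γ.Nonempty) (x : Euc N) :
    ∃ p, IsClosestPoint Γ x p := by
  obtain ⟨p, hp, h⟩ := hΓ.exists_infDist_eq_dist hne x
  exact ⟨p, hp, h.symm⟩

theorem IsClosestPoint.dist_le {x p v : Euc N} (h : IsClosestPoint Γ x p) (hv : v ∈ Γ) :
    dist x p ≤ dist x v := h.2.trans_le (Metric.infDist_le_dist_of_mem hv)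

theorem IsClosestPoint.dist_le_two_mul {x p v : Euc N} (h : IsClosestPoint Γ x p) (hv : v ∈ Γ) :
    dist p v ≤ 2 * dist x v := by
  have h1 := h.dist_le hv
  have h2 := dist_triangle_left p v x
  linarith

theorem isClosestPoint_of_forall {x p : Euc N} (hp : p ∈ Γ) (h : ∀ q ∈ Γ, dist x p ≤ dist x q) :
    IsClosestPoint Γ x p :=
  ⟨hp, le_antisymm ((Metric.le_infDist ⟨p, hp⟩).2 fun {y} hy => h y hy)
    (Metric.infDist_le_dist_of_mem hp)⟩

theorem surfaceProj_isClosestPoint {x : Euc N} (h : ∃ p, IsClosestPoint Γ x p) :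
    IsClosestPoint Γ x (surfaceProj Γ x) := Classical.epsilon_spec h

/-- The part of `Γ` in `D` is a surface of class `C^{1,1}` with (not normalized) normal field `m`,
quantified by the constant `L`. -/
structure IsNormalPatch (Γ D : Set (Euc N)) (m : Euc N → Euc N) (L : ℝ) : Prop where
  nonneg : 0 ≤ L
  one_le_norm : ∀ p ∈ Γ ∩ D, 1 ≤ ‖m p‖
  norm_sub_le : ∀ p ∈ Γ ∩ D, ∀ q ∈ Γ ∩ D, ‖m p - m q‖ ≤ L * ‖p - q‖
  abs_inner_le : ∀ p ∈ Γ ∩ D, ∀ q ∈ Γ ∩ D, |inner ℝ (m p) (q - p)| ≤ L * ‖q - p‖ ^ 2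
  normal : ∀ p ∈ Γ ∩ D, ∀ x, IsClosestPoint Γ x p → ∃ s : ℝ, x - p = s • m p
  infDist_le : ∀ v ∈ Γ ∩ D, ∀ x ∈ D,
    Metric.infDist x Γ ≤ |inner ℝ (m v) (x - v)| + L * ‖x - v‖ ^ 2

namespace IsNormalPatch

theorem abs_le_dist (h : IsNormalPatch Γ D m L) {x p : Euc N} {s : ℝ} (hp : p ∈ Γ ∩ D)
    (hx : x - p = s • m p) : |s| ≤ dist x p := by
  rw [dist_eq_norm, hx, norm_smul, Real.norm_eq_abs]
  exact le_mul_of_one_le_right (abs_nonneg _) (h.one_le_norm p hp)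

/-- Expand `|x - q|²` about `p`: the cross term is quadratic in `|p - q|` because the patch leaves
its tangent plane quadratically. Hence `p` beats every other point of the patch as soon as `2L|s| <
1`. -/
theorem sq_dist_add_le (h : IsNormalPatch Γ D m L) {x p q : Euc N} {s : ℝ} (hp : p ∈ Γ ∩ D)
    (hq : q ∈ Γ ∩ D) (hx : x - p = s • m p) :
    dist x p ^ 2 + (1 - 2 * L * |s|) * dist p q ^ 2 ≤ dist x q ^ 2 := by
  have h1 := h.abs_inner_le p hp q hq
  have e : x - q = (x - p) - (q - p) := by abel
  rw [dist_eq_norm, dist_comm p q, dist_eq_norm, dist_eq_norm x q, e, norm_sub_sq_real (x - p), hx,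
    real_inner_smul_left]
  have h2 : s * inner ℝ (m p) (q - p) ≤ |s| * (L * ‖q - p‖ ^ 2) :=
    (le_abs_self _).trans (by rw [abs_mul]; gcongr)
  linarith

theorem eq_of_dist_le (h : IsNormalPatch Γ D m L) {x p q : Euc N} {s : ℝ} (hp : p ∈ Γ ∩ D)
    (hq : q ∈ Γ ∩ D) (hx : x - p = s • m p) (hs : 2 * L * |s| < 1) (hd : dist x q ≤ dist x p) :
    q = p := by
  have h1 := h.sq_dist_add_le hp hq hx
  have h2 : dist x q ^ 2 ≤ dist x p ^ 2 := by gcongr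
  have h3 : dist p q ^ 2 ≤ 0 := by
    by_contra h4
    nlinarith [mul_pos (sub_pos.2 hs) (not_le.1 h4)]
  have h4 : dist p q = 0 := by nlinarith [dist_nonneg (x := p) (y := q), sq_nonneg (dist p q)]
  exact (dist_eq_zero.1 h4).symm

/-- The core estimate. With `n = s m(p) - t m(q)` one has `|x - y|² = |p - q|² + 2⟨p - q, n⟩ +
|n|²`; the cross term gives `4dL|p - q|²`, and the bracket that is squared bounds `|n|`. -/
theorem abs_sq_sub_sq_le (h : IsNormalPatch Γ D m L) {x y p q : Euc N} {s t d θ : ℝ}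
    (hp : p ∈ Γ ∩ D) (hq : q ∈ Γ ∩ D) (hx : x - p = s • m p) (hy : y - q = t • m q)
    (hs : |s| ≤ d) (ht : |t| ≤ d) (hθ : |inner ℝ (m p) (x - y)| ≤ θ * ‖x - y‖) :
    |‖x - y‖ ^ 2 - ‖p - q‖ ^ 2| ≤ 4 * d * L * ‖p - q‖ ^ 2 +
      (θ * ‖x - y‖ + L * ‖p - q‖ ^ 2 + 2 * d * L * ‖p - q‖) ^ 2 := by
  have hL := h.nonneg
  have hd : 0 ≤ d := (abs_nonneg _).trans hs
  set b := ‖p - q‖ with hb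
  have hbq : ‖q - p‖ = b := norm_sub_rev _ _
  have hb0 : 0 ≤ b := norm_nonneg _
  have ip := h.abs_inner_le p hp q hq
  have iq := h.abs_inner_le q hq p hp
  rw [hbq] at ip
  have hm := h.norm_sub_le p hp q hq
  have h1 := h.one_le_norm p hp
  set n := s • m p - t • m q with hn
  have e : x - y = (p - q) + n := by rw [hn, ← hx, ← hy]; abel
  -- Pairing `x - y = (p - q) + n` with `m p` isolates `(s - t)‖m p‖²`; the other terms are small by
  -- `hθ`, by the tangency of `p - q` and by the Lipschitz bound on `m`.
  have hst : |s - t| * ‖m p‖ ≤ θ * ‖x - y‖ + L * b ^ 2 + d * L * b := by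
    have e1 : inner ℝ (m p) (x - y) = - inner ℝ (m p) (q - p) + (s - t) * ‖m p‖ ^ 2
        + t * inner ℝ (m p) (m p - m q) := by
      rw [e, hn, inner_add_right, inner_sub_right, inner_sub_right, inner_sub_right,
        inner_sub_right, real_inner_smul_right, real_inner_smul_right, real_inner_self_eq_norm_sq]
      ring
    have e2 : |(s - t)| * ‖m p‖ ^ 2 ≤ θ * ‖x - y‖ + L * b ^ 2 + d * (‖m p‖ * (L * b)) := by
      have e3 : |t * inner ℝ (m p) (m p - m q)| ≤ d * (‖m p‖ * (L * b)) := by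
        rw [abs_mul]
        exact mul_le_mul ht ((abs_real_inner_le_norm _ _).trans (by gcongr)) (abs_nonneg _) hd
      rw [← abs_of_nonneg (sq_nonneg ‖m p‖), ← abs_mul, abs_le]
      rw [abs_le] at e3 hθ ip
      constructor <;> linarith [e3.1, e3.2, hθ.1, hθ.2, ip.1, ip.2]
    have e4 : 0 ≤ θ * ‖x - y‖ + L * b ^ 2 :=
      add_nonneg ((abs_nonneg _).trans hθ) (by positivity)
    have e5 : ‖m p‖ * (|s - t| * ‖m p‖) ≤ ‖m p‖ * (θ * ‖x - y‖ + L * b ^ 2 + d * L * b) := by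
      nlinarith [mul_nonneg (sub_nonneg.2 h1) e4]
    exact le_of_mul_le_mul_left e5 (by linarith)
  have hnn : ‖n‖ ≤ θ * ‖x - y‖ + L * b ^ 2 + 2 * d * L * b := by
    have e1 : n = (s - t) • m p + t • (m p - m q) := by rw [hn]; module
    calc ‖n‖ ≤ |s - t| * ‖m p‖ + |t| * ‖m p - m q‖ := by
          rw [e1]; refine (norm_add_le _ _).trans ?_
          rw [norm_smul, norm_smul, Real.norm_eq_abs, Real.norm_eq_abs]
      _ ≤ (θ * ‖x - y‖ + L * b ^ 2 + d * L * b) + d * (L * b) := by gcongr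
      _ = _ := by ring
  have hin : |inner ℝ (p - q) n| ≤ 2 * (d * (L * b ^ 2)) := by
    have e1 : inner ℝ (p - q) n = - (s * inner ℝ (m p) (q - p)) - t * inner ℝ (m q) (p - q) := by
      rw [hn, inner_sub_right, real_inner_smul_right, real_inner_smul_right,
        real_inner_comm, real_inner_comm (m q), ← neg_sub q p, inner_neg_right]
      ring
    have e2 : |s * inner ℝ (m p) (q - p)| ≤ d * (L * b ^ 2) := by
      rw [abs_mul]; exact mul_le_mul hs ip (abs_nonneg _) hd
    have e3 : |t * inner ℝ (m q) (p - q)| ≤ d * (L * b ^ 2) := by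
      rw [abs_mul]; exact mul_le_mul ht iq (abs_nonneg _) hd
    rw [e1]
    rw [abs_le] at e2 e3 ⊢
    constructor <;> linarith [e2.1, e2.2, e3.1, e3.2]
  have hsq : ‖x - y‖ ^ 2 = b ^ 2 + 2 * inner ℝ (p - q) n + ‖n‖ ^ 2 := by
    conv_lhs => rw [e]
    rw [norm_add_sq_real]
  have hn2 : ‖n‖ ^ 2 ≤ (θ * ‖x - y‖ + L * b ^ 2 + 2 * d * L * b) ^ 2 := by gcongr
  rw [abs_le] at hin ⊢
  constructor <;> nlinarith [hin.1, hin.2, sq_nonneg ‖n‖]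

end IsNormalPatch

/-- Uses `(1 + ε)/(1 - ε) ≤ (1 + 2ε)²` for `ε ≤ 1/2`. The hypothesis is symmetric in `a` and `b`, so
it yields both Lipschitz bounds. -/
theorem le_one_add_mul_of_abs_sq_sub_sq_le {a b ε : ℝ} (hb : 0 ≤ b) (h0 : 0 ≤ ε)
    (h1 : ε ≤ 1 / 2) (h : |a ^ 2 - b ^ 2| ≤ ε * (a ^ 2 + b ^ 2)) : a ≤ (1 + 2 * ε) * b := by
  refine le_of_sq_le_sq ?_ (by positivity)
  rw [abs_le] at h
  have h2 : (1 - ε) * a ^ 2 ≤ (1 + ε) * b ^ 2 := by linarith [h.2]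
  have h3 : (1 + ε) * b ^ 2 ≤ (1 - ε) * ((1 + 2 * ε) * b) ^ 2 := by
    have h4 : (1 + ε) ≤ (1 - ε) * (1 + 2 * ε) ^ 2 := by
      nlinarith [mul_nonneg h0 (by linarith : 0 ≤ 1 / 2 - ε), mul_nonneg h0 (mul_nonneg h0 (by linarith : 0 ≤ 1 / 2 - ε))]
    calc _ ≤ ((1 - ε) * (1 + 2 * ε) ^ 2) * b ^ 2 := by gcongr
      _ = _ := by ring
  exact le_of_mul_le_mul_left (h2.trans h3) (by linarith)

end ClosestPoint

/-! ### Faces of a regular triangulation with vertices on the surface -/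

/-- `S` is a face, with vertices on `Γ`, of a shape regular simplex of diameter at most `h`. -/
structure IsRegularFace {N : ℕ} (Γ : Set (Euc N)) (σ h : ℝ) (S : Finset (Euc N)) : Prop where
  card_eq : S.card = N
  vertices_mem : ∀ v ∈ S, v ∈ Γ
  exists_cell : ∃ T : Finset (Euc N), T.card = N + 1 ∧
    AffineIndependent ℝ (fun v : T => (v : Euc N)) ∧ S ⊆ T ∧
    Metric.diam (simplexHull T) ≤ h ∧
    Metric.diam (simplexHull T) ≤ σ * inscribedDiam (simplexHull T)

theorem isCompact_simplexHull {N : ℕ} (S : Finset (Euc N)) : IsCompact (simplexHull S) :=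
  S.finite_toSet.isCompact_convexHull ℝ

theorem subset_simplexHull {N : ℕ} {S : Finset (Euc N)} {v : Euc N} (hv : v ∈ S) :
    v ∈ simplexHull S := subset_convexHull ℝ _ hv

/-- The constant in the bi-Lipschitz estimate of the projection on a face. -/
def biLipConst (N : ℕ) (L σ : ℝ) : ℝ := 136 * L ^ 2 + 2 * (L * (2 * σ * N + 2)) ^ 2

theorem biLipConst_nonneg (N : ℕ) (L σ : ℝ) : 0 ≤ biLipConst N L σ := by
  unfold biLipConst; positivity

namespace IsRegularFace

variable {N : ℕ} {Γ D : Set (Euc N)} {m : Euc N → Euc N} {L σ h : ℝ} {S : Finset (Euc N)}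

theorem dist_le (hS : IsRegularFace Γ σ h S) {x y : Euc N} (hx : x ∈ simplexHull S)
    (hy : y ∈ simplexHull S) : dist x y ≤ h := by
  obtain ⟨T, -, -, hST, hd, -⟩ := hS.exists_cell
  have hsub : simplexHull S ⊆ simplexHull T := convexHull_mono (by exact_mod_cast hST)
  exact (Metric.dist_le_diam_of_mem (isCompact_simplexHull T).isBounded (hsub hx) (hsub hy)).trans hd

/-- The face is almost orthogonal to the normal: the linear function `⟨m v₀, · - v₀⟩` is at most `L
d²` at the vertices, and the simplex contains a ball of size comparable to `d/σ`, so its slope along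
the face is `O(σ N L h)`. Passing from `m v₀` to `m p` costs `L dist p v₀`. -/
theorem abs_inner_le (hS : IsRegularFace Γ σ h S) (hP : IsNormalPatch Γ D m L)
    (hSD : ∀ v ∈ S, v ∈ D) {v₀ p : Euc N} (hv₀ : v₀ ∈ S) (hp : p ∈ Γ ∩ D) {x y : Euc N}
    (hx : x ∈ simplexHull S) (hy : y ∈ simplexHull S) :
    |inner ℝ (m p) (x - y)| ≤ L * (2 * σ * N * h + dist p v₀) * ‖x - y‖ := by
  have hL := hP.nonneg
  by_cases hxy : x = y
  · simp [hxy]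
  have hn : 0 < ‖x - y‖ := norm_pos_iff.2 (sub_ne_zero.2 hxy)
  obtain ⟨T, hcard, haff, hST, hd, hσ⟩ := hS.exists_cell
  have hsub : simplexHull S ⊆ simplexHull T := convexHull_mono (by exact_mod_cast hST)
  set d := Metric.diam (simplexHull T) with hdT
  have hdist : ∀ u ∈ simplexHull S, ∀ v ∈ simplexHull S, ‖u - v‖ ≤ d := fun u hu v hv => by
    rw [← dist_eq_norm]
    exact Metric.dist_le_diam_of_mem (isCompact_simplexHull T).isBounded (hsub hu) (hsub hv)
  have hdpos : 0 < d := hn.trans_le (hdist x hx y hy)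
  have hi0 : 0 ≤ inscribedDiam (simplexHull T) := Real.sSup_nonneg fun ρ hρ => hρ.1
  have hi : 0 < inscribedDiam (simplexHull T) := by
    refine hi0.lt_of_ne fun h0 => ?_
    rw [← h0, mul_zero] at hσ
    linarith
  have hσ0 : 0 < σ := by
    by_contra hc
    nlinarith [mul_nonneg (neg_nonneg.2 (not_lt.1 hc)) hi0]
  -- No largest inscribed ball is needed: a ball of more than half the supremal diameter suffices,
  -- at the price of the factor 2 in `2σ`.
  obtain ⟨ρ, ⟨-, c, hc⟩, hρ⟩ := exists_lt_of_lt_csSup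
    (show {ρ : ℝ | 0 ≤ ρ ∧ ∃ c, Metric.closedBall c (ρ / 2) ⊆ simplexHull T}.Nonempty by
      by_contra hne
      rw [not_nonempty_iff_eq_empty] at hne
      rw [inscribedDiam, hne, Real.sSup_empty] at hi
      exact lt_irrefl _ hi)
    (show inscribedDiam (simplexHull T) / 2 < sSup _ from half_lt_self hi)
  have hρ0 : 0 < ρ := (half_pos hi).trans hρ
  have hdρ : d ≤ 2 * σ * ρ := by
    have : inscribedDiam (simplexHull T) ≤ 2 * ρ := by linarith
    calc d ≤ σ * inscribedDiam (simplexHull T) := hσ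
      _ ≤ σ * (2 * ρ) := by gcongr
      _ = _ := by ring
  have hv₀D : v₀ ∈ Γ ∩ D := ⟨hS.vertices_mem _ hv₀, hSD _ hv₀⟩
  have h1 : |inner ℝ (m v₀) (x - y)| ≤ 2 * σ * N * h * L * ‖x - y‖ := by
    have := abs_map_sub_le_of_simplex hcard haff hST (half_pos hρ0) hc
      (innerSL ℝ (m v₀)).toLinearMap (v₀ := v₀) (b := L * d ^ 2) (fun v hv => by
        have h2 := hP.abs_inner_le v₀ hv₀D v ⟨hS.vertices_mem _ hv, hSD _ hv⟩
        refine h2.trans ?_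
        have := hdist v (subset_simplexHull hv) v₀ (subset_simplexHull hv₀)
        gcongr) hx hy
    rw [hS.card_eq] at this
    refine this.trans ?_
    rw [show 2 * (ρ / 2) = ρ by ring]
    have h3 : d ^ 2 / ρ ≤ 2 * σ * h := by
      rw [div_le_iff₀ hρ0]
      calc d ^ 2 = d * d := sq _
        _ ≤ h * (2 * σ * ρ) := by gcongr; exact hdpos.le.trans hd
        _ = _ := by ring
    calc (N : ℝ) * (L * d ^ 2) * (‖x - y‖ / ρ) = N * L * ‖x - y‖ * (d ^ 2 / ρ) := by ring
      _ ≤ N * L * ‖x - y‖ * (2 * σ * h) := by gcongr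
      _ = _ := by ring
  have h2 : |inner ℝ (m p - m v₀) (x - y)| ≤ L * dist p v₀ * ‖x - y‖ := by
    refine (abs_real_inner_le_norm _ _).trans ?_
    rw [dist_eq_norm]
    exact mul_le_mul_of_nonneg_right (hP.norm_sub_le p hp v₀ hv₀D) (norm_nonneg _)
  rw [inner_sub_left] at h2
  rw [abs_le] at h1 h2 ⊢
  constructor <;> linarith [h1.1, h1.2, h2.1, h2.2]

/-- The height over the tangent plane at `v₀` is at most `L h²` at the vertices, hence on their
convex hull; the surface itself deviates from that plane by at most another `L h²`. -/
theorem infDist_le (hS : IsRegularFace Γ σ h S) (hP : IsNormalPatch Γ D m L) {R : ℝ}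
    {v₀ : Euc N} (hv₀ : v₀ ∈ S) (hball : Metric.ball v₀ R ⊆ D) (hR : h < R) {x : Euc N}
    (hx : x ∈ simplexHull S) : Metric.infDist x Γ ≤ 2 * L * h ^ 2 := by
  have hL := hP.nonneg
  have hnorm : ∀ u ∈ simplexHull S, ‖u - v₀‖ ≤ h := fun u hu => by
    rw [← dist_eq_norm]; exact hS.dist_le hu (subset_simplexHull hv₀)
  have hmem : ∀ u ∈ simplexHull S, u ∈ D := fun u hu => hball (by
    rw [Metric.mem_ball]; exact (hS.dist_le hu (subset_simplexHull hv₀)).trans_lt hR)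
  have hv₀D : v₀ ∈ Γ ∩ D := ⟨hS.vertices_mem _ hv₀, hmem _ (subset_simplexHull hv₀)⟩
  have h1 : |inner ℝ (m v₀) (x - v₀)| ≤ L * h ^ 2 := by
    have hsub : simplexHull S ⊆ {u | inner ℝ (m v₀) (u - v₀) ∈ Icc (-(L * h ^ 2)) (L * h ^ 2)} := by
      refine convexHull_min (fun v hv => ?_) ?_
      · have h2 := hP.abs_inner_le v₀ hv₀D v
          ⟨hS.vertices_mem _ hv, hmem _ (subset_simplexHull hv)⟩
        have h3 := hnorm v (subset_simplexHull hv)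
        exact abs_le.1 (h2.trans (by gcongr))
      · intro u hu v hv a b ha hb hab
        have := convex_Icc (-(L * h ^ 2)) (L * h ^ 2) hu hv ha hb hab
        have e : a • u + b • v - v₀ = a • (u - v₀) + b • (v - v₀) := by
          rw [smul_sub, smul_sub, sub_add_sub_comm, ← add_smul, hab, one_smul]
        rw [mem_ofPred_eq, e, inner_add_right, real_inner_smul_right, real_inner_smul_right]
        exact this
    exact abs_le.2 (hsub hx)
  have h2 := hP.infDist_le v₀ hv₀D x (hmem x hx)
  have h3 := hnorm x hx
  have h4 : L * ‖x - v₀‖ ^ 2 ≤ L * h ^ 2 := by gcongr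
  linarith

theorem exists_eq_smul (hS : IsRegularFace Γ σ h S) (hP : IsNormalPatch Γ D m L) {R : ℝ}
    {v₀ : Euc N} (hv₀ : v₀ ∈ S) (hball : Metric.ball v₀ R ⊆ D) (hR : 2 * h < R) (hh : 0 < h)
    {x p : Euc N} (hx : x ∈ simplexHull S) (hp : IsClosestPoint Γ x p) :
    p ∈ D ∧ dist p v₀ ≤ 2 * h ∧ ∃ s : ℝ, x - p = s • m p ∧ |s| ≤ 2 * L * h ^ 2 := by
  have h1 : dist p v₀ ≤ 2 * h := (hp.dist_le_two_mul (hS.vertices_mem _ hv₀)).trans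
    (by linarith [hS.dist_le hx (subset_simplexHull hv₀)])
  have hpD : p ∈ D := hball (by rw [Metric.mem_ball]; linarith)
  obtain ⟨s, hs⟩ := hP.normal p ⟨hp.1, hpD⟩ x hp
  refine ⟨hpD, h1, s, hs, (hP.abs_le_dist ⟨hp.1, hpD⟩ hs).trans ?_⟩
  rw [hp.2]
  exact hS.infDist_le hP hv₀ hball (by linarith) hx

theorem existsUnique_isClosestPoint (hΓ : IsClosed Γ) (hS : IsRegularFace Γ σ h S)
    (hP : IsNormalPatch Γ D m L) {R : ℝ}
    {v₀ : Euc N} (hv₀ : v₀ ∈ S) (hball : Metric.ball v₀ R ⊆ D) (hR : 2 * h < R) (hh : 0 < h)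
    (hLh : 4 * (L * h) ^ 2 < 1) {x : Euc N} (hx : x ∈ simplexHull S) :
    ∃! p, IsClosestPoint Γ x p := by
  obtain ⟨p, hp⟩ := exists_isClosestPoint hΓ ⟨v₀, hS.vertices_mem _ hv₀⟩ x
  refine ⟨p, hp, fun q hq => ?_⟩
  obtain ⟨hpD, -, s, hs, hs'⟩ := hS.exists_eq_smul hP hv₀ hball hR hh hx hp
  obtain ⟨hqD, -⟩ := hS.exists_eq_smul hP hv₀ hball hR hh hx hq
  refine hP.eq_of_dist_le ⟨hp.1, hpD⟩ ⟨hq.1, hqD⟩ hs ?_ (hq.dist_le hp.1)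
  calc 2 * L * |s| ≤ 2 * L * (2 * L * h ^ 2) := by
        have := hP.nonneg
        gcongr
    _ = 4 * (L * h) ^ 2 := by ring
    _ < 1 := hLh

theorem abs_sq_dist_sub_le (hS : IsRegularFace Γ σ h S)
    (hP : IsNormalPatch Γ D m L) {R : ℝ}
    {v₀ : Euc N} (hv₀ : v₀ ∈ S) (hball : Metric.ball v₀ R ⊆ D) (hR : 2 * h < R) (hh : 0 < h)
    (hLh : L * h ≤ 1) {x y p q : Euc N} (hx : x ∈ simplexHull S)
    (hy : y ∈ simplexHull S) (hp : IsClosestPoint Γ x p) (hq : IsClosestPoint Γ y q) :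
    |dist x y ^ 2 - dist p q ^ 2| ≤ biLipConst N L σ * h ^ 2 * (dist x y ^ 2 + dist p q ^ 2) := by
  have hL := hP.nonneg
  obtain ⟨hpD, hpv, s, hs, hs'⟩ := hS.exists_eq_smul hP hv₀ hball hR hh hx hp
  obtain ⟨hqD, hqv, t, ht, ht'⟩ := hS.exists_eq_smul hP hv₀ hball hR hh hy hq
  have hSD : ∀ v ∈ S, v ∈ D := fun v hv => hball (by
    rw [Metric.mem_ball]
    linarith [hS.dist_le (subset_simplexHull hv) (subset_simplexHull hv₀)])
  have hθ : |inner ℝ (m p) (x - y)| ≤ (L * (2 * σ * N + 2) * h) * ‖x - y‖ := by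
    refine (hS.abs_inner_le hP hSD hv₀ ⟨hp.1, hpD⟩ hx hy).trans ?_
    refine mul_le_mul_of_nonneg_right ?_ (norm_nonneg _)
    calc L * (2 * σ * N * h + dist p v₀) ≤ L * (2 * σ * N * h + 2 * h) := by gcongr
      _ = _ := by ring
  have key := hP.abs_sq_sub_sq_le ⟨hp.1, hpD⟩ ⟨hq.1, hqD⟩ hs ht hs' ht' hθ
  have hb : ‖p - q‖ ≤ 4 * h := by
    rw [← dist_eq_norm]; linarith [dist_triangle_right p q v₀]
  rw [dist_eq_norm, dist_eq_norm]
  set a := ‖x - y‖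
  set b := ‖p - q‖
  have ha0 : 0 ≤ a := norm_nonneg _
  have hb0 : 0 ≤ b := norm_nonneg _
  set κ := L * (2 * σ * N + 2)
  have hκ : 0 ≤ κ * h * a := (abs_nonneg _).trans hθ
  -- Both remaining terms are at most `4Lhb`, the first by `b ≤ 4h` and the second by `Lh ≤ 1`.
  have h1 : κ * h * a + L * b ^ 2 + 2 * (2 * L * h ^ 2) * L * b ≤ κ * h * a + 8 * L * h * b := by
    have h2 : L * b ^ 2 ≤ L * (4 * h) * b := by
      calc L * b ^ 2 = L * b * b := by ring
        _ ≤ L * (4 * h) * b := by gcongr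
    have h3 : 2 * (2 * L * h ^ 2) * L * b ≤ 4 * L * h * b := by
      calc 2 * (2 * L * h ^ 2) * L * b = (L * h) * (4 * L * h * b) := by ring
        _ ≤ 1 * (4 * L * h * b) := by gcongr
        _ = _ := one_mul _
    linarith
  have h2 : (κ * h * a + L * b ^ 2 + 2 * (2 * L * h ^ 2) * L * b) ^ 2 ≤
      2 * (κ * h * a) ^ 2 + 2 * (8 * L * h * b) ^ 2 := by
    calc _ ≤ (κ * h * a + 8 * L * h * b) ^ 2 := by gcongr
      _ ≤ _ := by nlinarith [sq_nonneg (κ * h * a - 8 * L * h * b)]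
  refine key.trans ?_
  have h3 : 0 ≤ L ^ 2 * h ^ 2 * a ^ 2 := by positivity
  have h4 : 0 ≤ κ ^ 2 * h ^ 2 * b ^ 2 := by positivity
  -- `136 = 8 + 2·8²`: 8 from the cross term with `d = 2Lh²`, the rest from squaring `8Lhb`.
  have h5 : biLipConst N L σ = 136 * L ^ 2 + 2 * κ ^ 2 := rfl
  rw [h5]
  nlinarith

theorem almostMeasurePreservingOn (hΓ : IsClosed Γ) (hS : IsRegularFace Γ σ h S)
    (hP : IsNormalPatch Γ D m L) {R : ℝ}
    {v₀ : Euc N} (hv₀ : v₀ ∈ S) (hball : Metric.ball v₀ R ⊆ D) (hR : 2 * h < R) (hh : 0 < h)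
    (hC : 2 * (biLipConst N L σ * h ^ 2) ≤ 1) :
    AlmostMeasurePreservingOn (surfaceMeasure N) (2 ^ (N - 1) * (2 * (biLipConst N L σ * h ^ 2)))
      (surfaceProj Γ) (simplexHull S) := by
  have hε : 0 ≤ biLipConst N L σ * h ^ 2 := mul_nonneg (biLipConst_nonneg _ _ _) (sq_nonneg _)
  have hLh : L * h ≤ 1 := by
    have h1 : 136 * L ^ 2 ≤ biLipConst N L σ := by
      unfold biLipConst; linarith [sq_nonneg (L * (2 * σ * N + 2))]
    have h2 : 136 * L ^ 2 * h ^ 2 ≤ biLipConst N L σ * h ^ 2 := by gcongr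
    by_contra h3
    nlinarith [not_le.1 h3]
  have hcp : ∀ x, IsClosestPoint Γ x (surfaceProj Γ x) := fun x =>
    surfaceProj_isClosestPoint (exists_isClosestPoint hΓ ⟨v₀, hS.vertices_mem _ hv₀⟩ x)
  refine almostMeasurePreservingOn_of_biLipschitz (isCompact_simplexHull S).isClosed.measurableSet
    (by linarith) hC (fun x hx y hy => ?_) (fun x hx y hy => ?_)
  · refine le_one_add_mul_of_abs_sq_sub_sq_le dist_nonneg hε (by linarith) ?_
    rw [abs_sub_comm, add_comm (dist _ _ ^ 2)]
    exact hS.abs_sq_dist_sub_le hP hv₀ hball hR hh hLh hx hy (hcp x) (hcp y)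
  · exact le_one_add_mul_of_abs_sq_sub_sq_le dist_nonneg hε (by linarith)
      (hS.abs_sq_dist_sub_le hP hv₀ hball hR hh hLh hx hy (hcp x) (hcp y))

end IsRegularFace

/-! ### Graphs of `C^{1,1}` functions -/

section Chart

variable {N : ℕ} (A : RigidCoord N) {α : ℝ} (φ : Euc (N - 1) → ℝ) {L : ℝ≥0}

/-- The point of the graph of `φ` over `z`. -/
noncomputable def graphPoint (z : Euc (N - 1)) : Euc N := A.symm (WithLp.toLp 2 (z, φ z))

/-- The normal `(-∇φ, 1)` to the graph of `φ` at the point `p`, expressed in the ambient space. -/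
noncomputable def graphNormal (p : Euc N) : Euc N :=
  A.linearIsometryEquiv.symm (WithLp.toLp 2
    (-(InnerProductSpace.toDual ℝ (Euc (N - 1))).symm (fderiv ℝ φ (A p).fst), (1 : ℝ)))

@[simp]
theorem coord_graphPoint_fst (z : Euc (N - 1)) : (A (graphPoint A φ z)).fst = z := by
  simp [graphPoint]

@[simp]
theorem coord_graphPoint_snd (z : Euc (N - 1)) : (A (graphPoint A φ z)).snd = φ z := by
  simp [graphPoint]

theorem coord_sub (x y : Euc N) : A.linearIsometryEquiv (x - y) = A x - A y := by
  simpa using A.map_vsub x y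

theorem coord_ext {x y : Euc N} (h1 : (A x).fst = (A y).fst) (h2 : (A x).snd = (A y).snd) :
    x = y := by
  apply A.injective
  apply WithLp.ofLp_injective
  exact Prod.ext h1 h2

theorem dist_sq_coord (x y : Euc N) :
    dist x y ^ 2 = ‖(A x).fst - (A y).fst‖ ^ 2 + ((A x).snd - (A y).snd) ^ 2 := by
  rw [← A.dist_map, dist_eq_norm, WithLp.prod_norm_sq_eq_of_L2]
  simp

theorem norm_fst_sub_le (x y : Euc N) : ‖(A x).fst - (A y).fst‖ ≤ dist x y := by
  refine le_of_sq_le_sq ?_ dist_nonneg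
  rw [dist_sq_coord A]
  linarith [sq_nonneg ((A x).snd - (A y).snd)]

theorem abs_snd_sub_le (x y : Euc N) : |(A x).snd - (A y).snd| ≤ dist x y := by
  refine le_of_sq_le_sq ?_ dist_nonneg
  rw [dist_sq_coord A, sq_abs]
  linarith [sq_nonneg ‖(A x).fst - (A y).fst‖]

theorem dist_le_add_coord (x y : Euc N) :
    dist x y ≤ ‖(A x).fst - (A y).fst‖ + |(A x).snd - (A y).snd| := by
  refine le_of_sq_le_sq ?_ (by positivity)
  rw [dist_sq_coord A, ← sq_abs ((A x).snd - (A y).snd)]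
  nlinarith [mul_nonneg (norm_nonneg ((A x).fst - (A y).fst)) (abs_nonneg ((A x).snd - (A y).snd))]

variable {φ}

theorem inner_graphNormal (p x y : Euc N) :
    inner ℝ (graphNormal A φ p) (x - y) =
      ((A x).snd - (A y).snd) - fderiv ℝ φ (A p).fst ((A x).fst - (A y).fst) := by
  rw [graphNormal, LinearIsometryEquiv.inner_map_eq_flip, LinearIsometryEquiv.symm_symm,
    coord_sub, WithLp.prod_inner_apply]
  simp [InnerProductSpace.toDual_symm_apply, inner_neg_left]
  ring

theorem one_le_norm_graphNormal (p : Euc N) : 1 ≤ ‖graphNormal A φ p‖ := by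
  refine le_of_sq_le_sq ?_ (norm_nonneg _)
  rw [graphNormal, LinearIsometryEquiv.norm_map, WithLp.prod_norm_sq_eq_of_L2]
  simp

theorem norm_graphNormal_le (p : Euc N) : ‖graphNormal A φ p‖ ≤ 1 + ‖fderiv ℝ φ (A p).fst‖ := by
  refine le_of_sq_le_sq ?_ (by positivity)
  rw [graphNormal, LinearIsometryEquiv.norm_map, WithLp.prod_norm_sq_eq_of_L2]
  simp
  nlinarith [norm_nonneg (fderiv ℝ φ (A p).fst)]

/-- Because the normal is not normalized, its last component is constant, and the Lipschitz constant
of the gradient carries over unchanged. -/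
theorem norm_graphNormal_sub (p q : Euc N) : ‖graphNormal A φ p - graphNormal A φ q‖ =
    ‖fderiv ℝ φ (A p).fst - fderiv ℝ φ (A q).fst‖ := by
  rw [graphNormal, graphNormal, ← map_sub, LinearIsometryEquiv.norm_map]
  refine (sq_eq_sq₀ (norm_nonneg _) (norm_nonneg _)).1 ?_
  rw [WithLp.prod_norm_sq_eq_of_L2]
  set J := (InnerProductSpace.toDual ℝ (Euc (N - 1))).symm
  change ‖-J (fderiv ℝ φ (A p).fst) - -J (fderiv ℝ φ (A q).fst)‖ ^ 2 + ‖(1 : ℝ) - 1‖ ^ 2 = _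
  rw [← neg_sub', norm_neg, ← map_sub, LinearIsometryEquiv.norm_map]
  simp

theorem coord_add_smul_graphNormal_fst (p : Euc N) (s : ℝ) :
    (A (p + s • graphNormal A φ p)).fst = (A p).fst - s •
      (InnerProductSpace.toDual ℝ (Euc (N - 1))).symm (fderiv ℝ φ (A p).fst) := by
  have h := coord_sub A (p + s • graphNormal A φ p) p
  rw [add_sub_cancel_left, map_smul, graphNormal, LinearIsometryEquiv.apply_symm_apply] at h
  have h2 := congrArg WithLp.fst h
  simp only [WithLp.sub_fst, WithLp.smul_fst] at h2
  rw [← graphNormal] at h2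
  rw [eq_add_of_sub_eq h2.symm]
  simp; abel

theorem coord_add_smul_graphNormal_snd (p : Euc N) (s : ℝ) :
    (A (p + s • graphNormal A φ p)).snd = (A p).snd + s := by
  have h := coord_sub A (p + s • graphNormal A φ p) p
  rw [add_sub_cancel_left, map_smul, graphNormal, LinearIsometryEquiv.apply_symm_apply] at h
  have h2 := congrArg WithLp.snd h
  simp only [WithLp.sub_snd, WithLp.smul_snd] at h2
  rw [← graphNormal] at h2
  rw [eq_add_of_sub_eq h2.symm]
  simp; abel

theorem differentiableAt_of_contDiffOn (hφ : ContDiffOn ℝ 1 φ (baseSet N α)) {z : Euc (N - 1)}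
    (hz : z ∈ baseSet N α) : DifferentiableAt ℝ φ z :=
  (hφ.differentiableOn (by norm_num)).differentiableAt (Metric.isOpen_ball.mem_nhds hz)

theorem taylor_bound (hφ : ContDiffOn ℝ 1 φ (baseSet N α))
    (hL : LipschitzOnWith L (fderiv ℝ φ) (baseSet N α)) {z w : Euc (N - 1)}
    (hz : z ∈ baseSet N α) (hw : w ∈ baseSet N α) :
    |φ z - φ w - fderiv ℝ φ w (z - w)| ≤ L * ‖z - w‖ ^ 2 := by
  -- On this convex set the gradient differs from that at `w` by at most `L‖z - w‖`, so the mean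
  -- value inequality suffices.
  have hs : Convex ℝ (baseSet N α ∩ Metric.closedBall w ‖z - w‖) :=
    (convex_ball _ _).inter (convex_closedBall _ _)
  have := hs.norm_image_sub_le_of_norm_fderiv_le' (f := φ) (φ := fderiv ℝ φ w) (C := L * ‖z - w‖)
    (fun u hu => differentiableAt_of_contDiffOn hφ hu.1) (fun u hu => ?_)
    ⟨hw, Metric.mem_closedBall_self (norm_nonneg _)⟩ ⟨hz, by simp [dist_eq_norm]⟩
  · rw [Real.norm_eq_abs] at this
    exact this.trans_eq (by ring)
  · rw [← dist_eq_norm]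
    refine (hL.dist_le_mul u hu.1 w hw).trans ?_
    have := Metric.mem_closedBall.1 hu.2
    gcongr

/-- A graph of a `C^{1,1}` function is a surface with Lipschitz normal field. -/
theorem isNormalPatch_of_graph {Γ D : Set (Euc N)} (hφ : ContDiffOn ℝ 1 φ (baseSet N α))
    (hL : LipschitzOnWith L (fderiv ℝ φ) (baseSet N α)) (hΓ : Γ ∩ D = graphSet A α φ)
    (hD : ∀ x ∈ D, (A x).fst ∈ baseSet N α) : IsNormalPatch Γ D (graphNormal A φ) L where
  nonneg := L.2
  one_le_norm p _ := one_le_norm_graphNormal A p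
  norm_sub_le p hp q hq := by
    rw [norm_graphNormal_sub, ← dist_eq_norm, ← dist_eq_norm]
    refine (hL.dist_le_mul _ (hD p hp.2) _ (hD q hq.2)).trans ?_
    rw [dist_eq_norm]
    exact mul_le_mul_of_nonneg_left (norm_fst_sub_le A p q) L.2
  abs_inner_le p hp q hq := by
    rw [inner_graphNormal, (hΓ ▸ hp : p ∈ graphSet A α φ).2, (hΓ ▸ hq : q ∈ graphSet A α φ).2]
    refine (taylor_bound hφ hL (hD q hq.2) (hD p hp.2)).trans ?_
    have := norm_fst_sub_le A q p
    rw [← dist_eq_norm q]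
    gcongr
  normal p hp x hx := by
    have hpΔ := hD p hp.2
    have hpφ := (hΓ ▸ hp : p ∈ graphSet A α φ).2
    set a := (A x).fst with ha
    set b := (A x).snd with hb
    set w := (A p).fst with hw
    -- The closest point minimizes the squared distance over the graph; the vanishing derivative
    -- says that the horizontal part of `x - p` is `-(b - φ w)∇φ(w)`, so `x - p` is `b - φ w` times
    -- the normal.
    have hmin : IsLocalMin (fun z => ‖a - z‖ ^ 2 + (b - φ z) ^ 2) w := by
      filter_upwards [Metric.isOpen_ball.mem_nhds hpΔ] with z hz
      have hg : graphPoint A φ z ∈ Γ := by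
        have : graphPoint A φ z ∈ graphSet A α φ := ⟨by rwa [coord_graphPoint_fst], by simp⟩
        rw [← hΓ] at this
        exact this.1
      have h1 := hx.dist_le hg
      have h2 : dist x p ^ 2 ≤ dist x (graphPoint A φ z) ^ 2 := by gcongr
      rw [dist_sq_coord A, dist_sq_coord A, hpφ] at h2
      simpa using h2
    have hd1 : HasFDerivAt (fun z => ‖a - z‖ ^ 2)
        (2 • (innerSL ℝ (a - w)).comp (-ContinuousLinearMap.id ℝ (Euc (N - 1)))) w :=
      ((hasFDerivAt_id w).const_sub a).norm_sq
    have hd2 : HasFDerivAt (fun z => (b - φ z) ^ 2)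
        ((2 * (b - φ w)) • (-fderiv ℝ φ w)) w := by
      have := ((differentiableAt_of_contDiffOn hφ hpΔ).hasFDerivAt.const_sub b).pow 2
      simpa using this
    have hz := hmin.hasFDerivAt_eq_zero (hd1.add hd2)
    have hz' : ∀ d, inner ℝ (a - w) d = -((b - φ w) * fderiv ℝ φ w d) := by
      intro d
      have := congrArg (fun l => l d) hz
      simp at this
      rw [inner_sub_left]
      linarith
    refine ⟨b - φ w, ?_⟩
    have hgrad : a - w = -((b - φ w) •
        (InnerProductSpace.toDual ℝ (Euc (N - 1))).symm (fderiv ℝ φ w)) := by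
      refine ext_inner_right ℝ fun d => ?_
      rw [hz', inner_neg_left, real_inner_smul_left, InnerProductSpace.toDual_symm_apply]
    have : x = p + (b - φ w) • graphNormal A φ p := by
      apply coord_ext A
      · rw [coord_add_smul_graphNormal_fst, ← ha, eq_add_of_sub_eq hgrad]; abel
      · rw [coord_add_smul_graphNormal_snd, hpφ]; ring
    rw [eq_comm, ← sub_eq_iff_eq_add'.2 this]
  infDist_le v hv x hx := by
    have hg : graphPoint A φ (A x).fst ∈ Γ := by
      have : graphPoint A φ (A x).fst ∈ graphSet A α φ := ⟨by rw [coord_graphPoint_fst]; exact hD x hx, by simp⟩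
      rw [← hΓ] at this
      exact this.1
    -- The vertical distance to the graph bounds the distance to `Γ`.
    have h1 : dist x (graphPoint A φ (A x).fst) ≤ |(A x).snd - φ (A x).fst| := by
      simpa using dist_le_add_coord A x (graphPoint A φ (A x).fst)
    refine (Metric.infDist_le_dist_of_mem hg).trans (h1.trans ?_)
    rw [inner_graphNormal, (hΓ ▸ hv : v ∈ graphSet A α φ).2]
    have h2 := taylor_bound hφ hL (hD x hx) (hD v hv.2)
    have h3 : (L : ℝ) * ‖(A x).fst - (A v).fst‖ ^ 2 ≤ L * ‖x - v‖ ^ 2 := by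
      have := norm_fst_sub_le A x v
      rw [← dist_eq_norm x]
      gcongr
    set P := fderiv ℝ φ (A v).fst ((A x).fst - (A v).fst)
    have h4 := abs_sub_le (A x).snd (φ (A v).fst + P) (φ (A x).fst)
    rw [abs_sub_comm (φ (A v).fst + P)] at h4
    rw [← sub_sub, ← sub_sub] at h4
    linarith

end Chart

/-! ### Charts of a `C^{1,1}` domain -/

namespace C11Atlas

variable {N : ℕ} {Ω : Set (Euc N)} (𝒜 : C11Atlas Ω)

/-- `Ω`, its frontier and its exterior partition the space, so the three chart identities force `U
r` to be the full tube of height `β` on either side of the graph. -/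
theorem mem_U_iff (hΩ : IsOpen Ω) (r : Fin 𝒜.M) (x : Euc N) : x ∈ 𝒜.U r ↔
    (𝒜.coord r x).fst ∈ baseSet N 𝒜.α ∧
      |(𝒜.coord r x).snd - 𝒜.φ r (𝒜.coord r x).fst| < 𝒜.β := by
  have hβ := 𝒜.β_pos
  constructor
  · intro hx
    by_cases h1 : x ∈ Ω
    · have : x ∈ upperSide (𝒜.coord r) 𝒜.α 𝒜.β (𝒜.φ r) := 𝒜.inside_eq r ▸ ⟨h1, hx⟩
      exact ⟨this.1, by rw [abs_lt]; constructor <;> linarith [this.2.1, this.2.2]⟩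
    by_cases h2 : x ∈ closure Ω
    · have : x ∈ graphSet (𝒜.coord r) 𝒜.α (𝒜.φ r) :=
        𝒜.frontier_eq r ▸ ⟨⟨h2, by rwa [hΩ.interior_eq]⟩, hx⟩
      exact ⟨this.1, by rw [this.2]; simpa using hβ⟩
    · have : x ∈ lowerSide (𝒜.coord r) 𝒜.α 𝒜.β (𝒜.φ r) := 𝒜.outside_eq r ▸ ⟨h2, hx⟩
      exact ⟨this.1, by rw [abs_lt]; constructor <;> linarith [this.2.1, this.2.2]⟩
  · rintro ⟨h1, h2⟩
    rw [abs_lt] at h2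
    rcases lt_trichotomy (𝒜.coord r x).snd (𝒜.φ r (𝒜.coord r x).fst) with h | h | h
    · have : x ∈ lowerSide (𝒜.coord r) 𝒜.α 𝒜.β (𝒜.φ r) := ⟨h1, by linarith, h⟩
      rw [← 𝒜.outside_eq r] at this
      exact this.2
    · have : x ∈ graphSet (𝒜.coord r) 𝒜.α (𝒜.φ r) := ⟨h1, h⟩
      rw [← 𝒜.frontier_eq r] at this
      exact this.2
    · have : x ∈ upperSide (𝒜.coord r) 𝒜.α 𝒜.β (𝒜.φ r) := ⟨h1, h, by linarith⟩
      rw [← 𝒜.inside_eq r] at this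
      exact this.2

/-- Constants that are valid for all charts of an atlas: a Lipschitz constant `L` of the gradients,
a bound `B` of the gradients and a Lebesgue number `R` of the covering. -/
theorem exists_constants (hΩ : IsC11Domain Ω) : ∃ L B : ℝ≥0, ∃ R > 0,
    (∀ r, LipschitzOnWith L (fderiv ℝ (𝒜.φ r)) (baseSet N 𝒜.α)) ∧
    (∀ r, ∀ z ∈ baseSet N 𝒜.α, ‖fderiv ℝ (𝒜.φ r) z‖ ≤ B) ∧
    (∀ x ∈ frontier Ω, ∃ r, Metric.ball x R ⊆ 𝒜.U r) := by
  choose l hl using 𝒜.lipschitz_fderiv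
  obtain ⟨R, hR, hcov⟩ := lebesgue_number_lemma_of_metric
    (hΩ.isBounded.isCompact_closure.of_isClosed_subset isClosed_frontier frontier_subset_closure)
    𝒜.isOpen_U 𝒜.cover
  have hl' : ∀ r, l r ≤ ∑ r, l r := fun r =>
    Finset.single_le_sum (f := l) (fun _ _ => zero_le) (Finset.mem_univ r)
  refine ⟨∑ r, l r, ∑ r, (‖fderiv ℝ (𝒜.φ r) 0‖₊ + l r * ⟨𝒜.α, 𝒜.α_pos.le⟩), R, hR,
    fun r => (hl r).weaken (hl' r), fun r z hz => ?_, hcov⟩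
  have h0 : (0 : Euc (N - 1)) ∈ baseSet N 𝒜.α := Metric.mem_ball_self 𝒜.α_pos
  have h1 := (hl r).dist_le_mul z hz 0 h0
  have h2 : dist z 0 ≤ 𝒜.α := (Metric.mem_ball.1 hz).le
  have h3 : ‖fderiv ℝ (𝒜.φ r) 0‖₊ + l r * ⟨𝒜.α, 𝒜.α_pos.le⟩ ≤
      ∑ r, (‖fderiv ℝ (𝒜.φ r) 0‖₊ + l r * ⟨𝒜.α, 𝒜.α_pos.le⟩) :=
    Finset.single_le_sum (f := fun r => ‖fderiv ℝ (𝒜.φ r) 0‖₊ + l r * ⟨𝒜.α, 𝒜.α_pos.le⟩)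
      (fun _ _ => zero_le) (Finset.mem_univ r)
  refine le_trans ?_ (NNReal.coe_le_coe.2 h3)
  push_cast
  rw [dist_eq_norm] at h1
  have h4 := norm_le_norm_add_norm_sub' (fderiv ℝ (𝒜.φ r) z) (fderiv ℝ (𝒜.φ r) 0)
  have h5 : (l r : ℝ) * dist z 0 ≤ l r * 𝒜.α := by gcongr
  exact h4.trans (add_le_add le_rfl (h1.trans h5))

theorem isNormalPatch (hΩ : IsOpen Ω) {L : ℝ≥0} {r : Fin 𝒜.M}
    (hL : LipschitzOnWith L (fderiv ℝ (𝒜.φ r)) (baseSet N 𝒜.α)) :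
    IsNormalPatch (frontier Ω) (𝒜.U r) (graphNormal (𝒜.coord r) (𝒜.φ r)) L :=
  isNormalPatch_of_graph _ (𝒜.contDiffOn r) hL (𝒜.frontier_eq r)
    fun x hx => ((𝒜.mem_U_iff hΩ r x).1 hx).1

end C11Atlas

/-! ### The projection of the discrete boundary onto the boundary -/

namespace Triangulation

variable {N : ℕ} (𝒯 : Triangulation N)

theorem finite_boundaryMesh : 𝒯.boundaryMesh.Finite := by
  refine (𝒯.cells.biUnion Finset.powerset).finite_toSet.subset ?_
  rintro S ⟨-, ⟨T, hT, hST⟩, -⟩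
  simpa using ⟨T, hT, hST⟩

theorem simplexHull_subset_boundary {S : Finset (Euc N)} (hS : S ∈ 𝒯.boundaryMesh) :
    simplexHull S ⊆ 𝒯.boundary := subset_biUnion_of_mem (u := fun S => simplexHull S) hS

end Triangulation

section Bijectivity

variable {N : ℕ} {Ω : Set (Euc N)} {𝒜 : C11Atlas Ω} {σ h : ℝ} {𝒯 : Triangulation N}

theorem IsAdmissible.isRegularFace (h𝒯 : IsAdmissible 𝒜 σ h 𝒯) {S : Finset (Euc N)}
    (hS : S ∈ 𝒯.boundaryMesh) : IsRegularFace (frontier Ω) σ h S := by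
  obtain ⟨hc, ⟨T, hT, hST⟩, -⟩ := id hS
  exact ⟨hc, h𝒯.vertices_mem S hS, T, 𝒯.card_eq T hT, 𝒯.affineIndependent T hT, hST,
    h𝒯.diam_le T hT, h𝒯.shape_regular T hT⟩

theorem IsRegularFace.nonempty (hN : 0 < N) {Γ : Set (Euc N)} {S : Finset (Euc N)}
    (hS : IsRegularFace Γ σ h S) : S.Nonempty := by
  rw [← Finset.card_pos, hS.card_eq]; exact hN

theorem IsAdmissible.dist_le_of_isClosestPoint (hN : 0 < N) (h𝒯 : IsAdmissible 𝒜 σ h 𝒯)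
    {x p : Euc N} (hx : x ∈ 𝒯.boundary) (hp : IsClosestPoint (frontier Ω) x p) :
    dist x p ≤ h := by
  obtain ⟨S, hS, hxS⟩ := mem_iUnion₂.1 hx
  have hF := h𝒯.isRegularFace hS
  obtain ⟨v, hv⟩ := hF.nonempty hN
  exact (hp.dist_le (hF.vertices_mem v hv)).trans (hF.dist_le hxS (subset_simplexHull hv))

theorem mem_baseSet_of_ball_subset (hΩ : IsOpen Ω) {r : Fin 𝒜.M} {p : Euc N} {R : ℝ}
    (hball : Metric.ball p R ⊆ 𝒜.U r) {z : Euc (N - 1)}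
    (hz : ‖z - (𝒜.coord r p).fst‖ < R) : z ∈ baseSet N 𝒜.α := by
  have h1 : graphPoint (𝒜.coord r) (fun _ => (𝒜.coord r p).snd) z ∈ 𝒜.U r := by
    apply hball
    rw [Metric.mem_ball]
    refine (dist_le_add_coord (𝒜.coord r) _ _).trans_lt ?_
    simpa using hz
  simpa only [coord_graphPoint_fst] using ((𝒜.mem_U_iff hΩ r _).1 h1).1

variable {r : Fin 𝒜.M} {φh : Euc (N - 1) → ℝ}

/-- A boundary face over the base set that meets the domain of a chart lies in it. -/
theorem simplexHull_subset_U (hc : ContinuousOn φh (baseSet N 𝒜.α))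
    (hg : 𝒯.boundary ∩ 𝒜.U r = graphSet (𝒜.coord r) 𝒜.α φh) {S : Finset (Euc N)}
    (hS : S ∈ 𝒯.boundaryMesh)
    (hbase : ∀ x ∈ simplexHull S, (𝒜.coord r x).fst ∈ baseSet N 𝒜.α)
    (hne : (simplexHull S ∩ 𝒜.U r).Nonempty) : simplexHull S ⊆ 𝒜.U r := by
  set A := 𝒜.coord r
  have hfst : Continuous fun x => (A x).fst := (WithLp.continuous_fst _ _ _).comp A.continuous
  have hsnd : Continuous fun x => (A x).snd := (WithLp.continuous_snd _ _ _).comp A.continuous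
  -- Over the base set, `V` is the complement of the graph of `φh`. On the face, `U r` and `V` are
  -- disjoint open sets that cover it, so connectedness leaves only one of them.
  set V := {x | (A x).fst ∈ baseSet N 𝒜.α ∧ (A x).snd ≠ φh (A x).fst} with hV
  have hVo : IsOpen V := by
    have h1 : IsOpen ((fun x => (A x).fst) ⁻¹' baseSet N 𝒜.α) :=
      Metric.isOpen_ball.preimage hfst
    have h2 : ContinuousOn (fun x => (A x).snd - φh (A x).fst)
        ((fun x => (A x).fst) ⁻¹' baseSet N 𝒜.α) :=
      hsnd.continuousOn.sub (hc.comp hfst.continuousOn fun x hx => hx)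
    have h3 := h2.isOpen_inter_preimage h1 (isOpen_compl_singleton (x := (0 : ℝ)))
    convert h3 using 1
    ext x
    simp [hV, sub_eq_zero]
  have hpre : IsPreconnected (simplexHull S) := (convex_convexHull ℝ _).isPreconnected
  have hcover : simplexHull S ⊆ 𝒜.U r ∪ V := fun x hx => by
    by_cases h : (A x).snd = φh (A x).fst
    · have : x ∈ 𝒯.boundary ∩ 𝒜.U r := hg ▸ ⟨hbase x hx, h⟩
      exact Or.inl this.2
    · exact Or.inr ⟨hbase x hx, h⟩
  have hdisj : simplexHull S ∩ (𝒜.U r ∩ V) = ∅ := by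
    rw [eq_empty_iff_forall_notMem]
    rintro x ⟨hx, hxU, hxV⟩
    have : x ∈ graphSet A 𝒜.α φh := hg ▸ ⟨𝒯.simplexHull_subset_boundary hS hx, hxU⟩
    exact hxV.2 this.2
  rcases isPreconnected_iff_subset_of_disjoint.1 hpre _ _ (𝒜.isOpen_U r) hVo hcover hdisj with h | h
  · exact h
  · obtain ⟨x, hx, hxU⟩ := hne
    have : x ∈ simplexHull S ∩ (𝒜.U r ∩ V) := ⟨hx, hxU, h hx⟩
    rw [hdisj] at this
    exact this.elim

theorem subset_U_of_graphPoint_mem (hΩ : IsOpen Ω)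
    (h𝒯 : IsAdmissible 𝒜 σ h 𝒯) (hc : ContinuousOn φh (baseSet N 𝒜.α))
    (hg : 𝒯.boundary ∩ 𝒜.U r = graphSet (𝒜.coord r) 𝒜.α φh) (hh : 0 < h)
    {p : Euc N} {R : ℝ} (hball : Metric.ball p R ⊆ 𝒜.U r) {z : Euc (N - 1)}
    (hz : ‖z - (𝒜.coord r p).fst‖ + h < R) {S : Finset (Euc N)} (hS : S ∈ 𝒯.boundaryMesh)
    (hzS : graphPoint (𝒜.coord r) φh z ∈ simplexHull S) : simplexHull S ⊆ 𝒜.U r := by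
  have hF := h𝒯.isRegularFace hS
  refine simplexHull_subset_U hc hg hS (fun x hx => ?_) ⟨_, hzS, ?_⟩
  · apply mem_baseSet_of_ball_subset hΩ hball
    have h1 := norm_fst_sub_le (𝒜.coord r) x (graphPoint (𝒜.coord r) φh z)
    rw [coord_graphPoint_fst] at h1
    have h2 := hF.dist_le hx hzS
    have h3 := norm_sub_le_norm_sub_add_norm_sub (𝒜.coord r x).fst z (𝒜.coord r p).fst
    linarith
  · have : graphPoint (𝒜.coord r) φh z ∈ 𝒯.boundary ∩ 𝒜.U r := by
      rw [hg]
      refine ⟨?_, by simp⟩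
      rw [coord_graphPoint_fst]
      exact mem_baseSet_of_ball_subset hΩ hball (by linarith)
    exact this.2

variable {B : ℝ≥0}

theorem abs_sub_le_of_mem_baseSet (hB : ∀ z ∈ baseSet N 𝒜.α, ‖fderiv ℝ (𝒜.φ r) z‖ ≤ B)
    {z w : Euc (N - 1)} (hz : z ∈ baseSet N 𝒜.α) (hw : w ∈ baseSet N 𝒜.α) :
    |𝒜.φ r z - 𝒜.φ r w| ≤ B * ‖z - w‖ :=
  (convex_ball _ _).norm_image_sub_le_of_norm_fderiv_le
    (fun _ hu => differentiableAt_of_contDiffOn (𝒜.contDiffOn r) hu) hB hw hz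

/-- The function describing `Γ_h` in a chart is close to the one describing `Γ`. -/
theorem abs_sub_le_of_graph (hN : 0 < N) (hΩ : IsOpen Ω)
    (h𝒯 : IsAdmissible 𝒜 σ h 𝒯) (hc : ContinuousOn φh (baseSet N 𝒜.α))
    (hg : 𝒯.boundary ∩ 𝒜.U r = graphSet (𝒜.coord r) 𝒜.α φh) (hh : 0 < h)
    (hB : ∀ z ∈ baseSet N 𝒜.α, ‖fderiv ℝ (𝒜.φ r) z‖ ≤ B)
    {p : Euc N} {R : ℝ} (hball : Metric.ball p R ⊆ 𝒜.U r) {z : Euc (N - 1)}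
    (hz : ‖z - (𝒜.coord r p).fst‖ + h < R) : |φh z - 𝒜.φ r z| ≤ (1 + B) * h := by
  set A := 𝒜.coord r
  have hzΔ : z ∈ baseSet N 𝒜.α := mem_baseSet_of_ball_subset hΩ hball (by linarith)
  have hw : graphPoint A φh z ∈ 𝒯.boundary ∩ 𝒜.U r := by
    rw [hg]
    exact ⟨by rwa [coord_graphPoint_fst], by simp⟩
  obtain ⟨S, hS, hwS⟩ := mem_iUnion₂.1 hw.1
  have hF := h𝒯.isRegularFace hS
  have hSU := subset_U_of_graphPoint_mem hΩ h𝒯 hc hg hh hball hz hS hwS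
  -- A vertex of the face lies on both surfaces within distance `h`; the gradient bound `B`
  -- transfers the height of `Γ` from the vertex to `z`.
  obtain ⟨v, hv⟩ := hF.nonempty hN
  have hvS := subset_simplexHull hv
  have hvg : v ∈ graphSet A 𝒜.α (𝒜.φ r) := 𝒜.frontier_eq r ▸ ⟨hF.vertices_mem v hv, hSU hvS⟩
  have h1 := abs_snd_sub_le A (graphPoint A φh z) v
  have h2 := norm_fst_sub_le A (graphPoint A φh z) v
  rw [coord_graphPoint_snd, hvg.2] at h1
  rw [coord_graphPoint_fst, norm_sub_rev] at h2
  have h3 := hF.dist_le hwS hvS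
  have h4 := abs_sub_le_of_mem_baseSet hB hvg.1 hzΔ
  have h5 : (B : ℝ) * ‖(A v).fst - z‖ ≤ B * h := by gcongr; exact h2.trans h3
  have h6 := abs_sub_le (φh z) (𝒜.φ r (A v).fst) (𝒜.φ r z)
  linarith

/-- The projection of `Γ_h` onto `Γ` is onto. -/
theorem exists_mem_boundary_isClosestPoint (hN : 0 < N) (hΩ : IsOpen Ω)
    (h𝒯 : IsAdmissible 𝒜 σ h 𝒯) (hh : 0 < h) {L : ℝ≥0}
    (hL : LipschitzOnWith L (fderiv ℝ (𝒜.φ r)) (baseSet N 𝒜.α))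
    (hB : ∀ z ∈ baseSet N 𝒜.α, ‖fderiv ℝ (𝒜.φ r) z‖ ≤ B)
    {p : Euc N} (hp : p ∈ frontier Ω) {R ε : ℝ} (hball : Metric.ball p R ⊆ 𝒜.U r)
    (hε : 0 < ε) (hεL : 4 * (L * ε) ≤ 1) (hεR : 2 * (ε * (1 + B)) < R) (hhR : 2 * h < R)
    (hhε : 2 * ((1 + B) * h) < ε) :
    ∃ x ∈ 𝒯.boundary, IsClosestPoint (frontier Ω) x p := by
  obtain ⟨φh, hc, hg⟩ := h𝒯.graph r
  have hR : 0 < R := by linarith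
  have hP := 𝒜.isNormalPatch hΩ hL
  set A := 𝒜.coord r
  set φ := 𝒜.φ r
  set m := graphNormal A φ
  have hpU : p ∈ 𝒜.U r := hball (Metric.mem_ball_self hR)
  have hpg : p ∈ graphSet A 𝒜.α φ := 𝒜.frontier_eq r ▸ ⟨hp, hpU⟩
  have hm1 : 1 ≤ ‖m p‖ := one_le_norm_graphNormal A p
  have hm2 : ‖m p‖ ≤ 1 + B := (norm_graphNormal_le A p).trans (by gcongr; exact hB _ hpg.1)
  set x : ℝ → Euc N := fun s => p + s • m p with hx
  have hxp : ∀ s, x s - p = s • m p := fun s => by simp [hx]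
  have hdist : ∀ s ∈ Icc (-ε) ε, dist (x s) p ≤ ε * (1 + B) := fun s hs => by
    rw [dist_eq_norm, hxp, norm_smul, Real.norm_eq_abs]
    have := abs_le.2 hs
    gcongr
  have hnear : ∀ s ∈ Icc (-ε) ε, ‖(A (x s)).fst - (A p).fst‖ + h < R := fun s hs => by
    have := norm_fst_sub_le A (x s) p
    linarith [hdist s hs]
  have hbase : ∀ s ∈ Icc (-ε) ε, (A (x s)).fst ∈ baseSet N 𝒜.α := fun s hs =>
    mem_baseSet_of_ball_subset hΩ hball (by linarith [hnear s hs])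
  -- The height of `x s` above `Γ` is `s‖m p‖²` up to the Taylor remainder of `φ`.
  have hheight : ∀ s ∈ Icc (-ε) ε,
      |(A (x s)).snd - φ (A (x s)).fst - s * ‖m p‖ ^ 2| ≤ L * s ^ 2 * ‖m p‖ ^ 2 := fun s hs => by
    have h1 := taylor_bound (𝒜.contDiffOn r) hL (hbase s hs) hpg.1
    have h2 := inner_graphNormal A (φ := φ) p (x s) p
    rw [hxp, real_inner_smul_right, real_inner_self_eq_norm_sq] at h2
    have h3 : ‖(A (x s)).fst - (A p).fst‖ ^ 2 ≤ s ^ 2 * ‖m p‖ ^ 2 := by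
      have h4 := norm_fst_sub_le A (x s) p
      rw [dist_eq_norm, hxp, norm_smul] at h4
      calc _ ≤ (‖s‖ * ‖m p‖) ^ 2 := by gcongr
        _ = _ := by rw [mul_pow, Real.norm_eq_abs, sq_abs]
    have h5 : (L : ℝ) * ‖(A (x s)).fst - (A p).fst‖ ^ 2 ≤ L * s ^ 2 * ‖m p‖ ^ 2 := by
      rw [mul_assoc]; gcongr
    rw [h2, hpg.2]
    rw [abs_sub_comm]
    refine le_trans (le_of_eq ?_) (h1.trans h5)
    congr 1
    ring
  set g : ℝ → ℝ := fun s => (A (x s)).snd - φh (A (x s)).fst with hgdef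
  have hxc : Continuous x := by fun_prop
  have hfst : Continuous fun x => (A x).fst := (WithLp.continuous_fst _ _ _).comp A.continuous
  have hsnd : Continuous fun x => (A x).snd := (WithLp.continuous_snd _ _ _).comp A.continuous
  have hgc : ContinuousOn g (Icc (-ε) ε) :=
    (hsnd.comp hxc).continuousOn.sub (hc.comp (hfst.comp hxc).continuousOn hbase)
  have hM : 1 ≤ ‖m p‖ ^ 2 := one_le_pow₀ hm1
  -- At `s = ±ε` the height over `Γ` is at least `3ε/4` in absolute value, while `φh` and `φ` differ
  -- by less than `ε/2`: hence `g` changes sign.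
  have hLM : L * ε ^ 2 * ‖m p‖ ^ 2 ≤ ε * ‖m p‖ ^ 2 / 4 := by
    have : 4 * (L * ε) * (ε * ‖m p‖ ^ 2) ≤ 1 * (ε * ‖m p‖ ^ 2) := by gcongr
    nlinarith
  have hεM : ε ≤ ε * ‖m p‖ ^ 2 := le_mul_of_one_le_right hε.le hM
  have hclose : ∀ s ∈ Icc (-ε) ε, |φh (A (x s)).fst - φ (A (x s)).fst| ≤ (1 + B) * h :=
    fun s hs => abs_sub_le_of_graph hN hΩ h𝒯 hc hg hh hB hball (hnear s hs)
  have hl : -ε ∈ Icc (-ε) ε := ⟨le_rfl, by linarith⟩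
  have hr : ε ∈ Icc (-ε) ε := ⟨by linarith, le_rfl⟩
  have hgl : g (-ε) ≤ 0 := by
    have h1 := (abs_le.1 (hheight _ hl)).2
    have h2 := (abs_le.1 (hclose _ hl)).1
    rw [neg_sq] at h1
    simp only [hgdef]
    linarith
  have hgr : 0 ≤ g ε := by
    have h1 := (abs_le.1 (hheight _ hr)).1
    have h2 := (abs_le.1 (hclose _ hr)).2
    simp only [hgdef]
    linarith
  obtain ⟨s, hs, hs0⟩ := intermediate_value_Icc (by linarith) hgc ⟨hgl, hgr⟩
  have hxΓ : x s ∈ 𝒯.boundary ∩ 𝒜.U r := hg ▸ ⟨hbase s hs, sub_eq_zero.1 hs0⟩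
  refine ⟨x s, hxΓ.1, ?_⟩
  obtain ⟨q, hq⟩ := exists_isClosestPoint isClosed_frontier ⟨p, hp⟩ (x s)
  have hqU : q ∈ 𝒜.U r := hball (by
    rw [Metric.mem_ball]
    linarith [hq.dist_le_two_mul hp, hdist s hs])
  have h1 := hP.sq_dist_add_le ⟨hp, hpU⟩ ⟨hq.1, hqU⟩ (hxp s)
  have h2 : 2 * L * |s| ≤ 1 := by
    have : (L : ℝ) * |s| ≤ L * ε := by
      have := abs_le.2 hs
      gcongr
    linarith
  have h3 : dist (x s) p ≤ dist (x s) q := by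
    refine le_of_sq_le_sq ?_ dist_nonneg
    nlinarith [mul_nonneg (sub_nonneg.2 h2) (sq_nonneg (dist p q))]
  exact isClosestPoint_of_forall hp fun q' hq' => h3.trans (hq.dist_le hq')

/-- The projection of `Γ_h` onto `Γ` is one-to-one. -/
theorem eq_of_isClosestPoint (hN : 0 < N) (hΩ : IsOpen Ω)
    (h𝒯 : IsAdmissible 𝒜 σ h 𝒯) (hh : 0 < h) {L : ℝ≥0}
    (hL : LipschitzOnWith L (fderiv ℝ (𝒜.φ r)) (baseSet N 𝒜.α))
    (hB : ∀ z ∈ baseSet N 𝒜.α, ‖fderiv ℝ (𝒜.φ r) z‖ ≤ B)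
    {p : Euc N} {R : ℝ} (hball : Metric.ball p R ⊆ 𝒜.U r) (hhR : 2 * h < R)
    (hhL : 4 * (1 + B) * (L * (2 * |σ| * N + (3 + 2 * B)) * h) ≤ 1)
    {x₁ x₂ : Euc N} (hx₁ : x₁ ∈ 𝒯.boundary) (hx₂ : x₂ ∈ 𝒯.boundary)
    (hp₁ : IsClosestPoint (frontier Ω) x₁ p) (hp₂ : IsClosestPoint (frontier Ω) x₂ p) :
    x₁ = x₂ := by
  obtain ⟨φh, hc, hg⟩ := h𝒯.graph r
  have hR : 0 < R := by linarith
  have hP := 𝒜.isNormalPatch hΩ hL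
  set A := 𝒜.coord r
  set φ := 𝒜.φ r
  set m := graphNormal A φ
  -- Bounds the inclination of the faces towards `m p` along the path below; `3 + 2B` is the
  -- distance from `p` to a vertex in units of `h`. With `|σ|`, `θ ≥ 0` holds for every real `σ`.
  set θ := L * (2 * |σ| * N + (3 + 2 * B)) * h with hθ
  have hθ0 : 0 ≤ θ := by positivity
  have hθ1 : 4 * θ ≤ 1 := by nlinarith [mul_nonneg B.2 hθ0]
  have hpU : p ∈ 𝒜.U r := hball (Metric.mem_ball_self hR)
  have hpg : p ∈ graphSet A 𝒜.α φ := 𝒜.frontier_eq r ▸ ⟨hp₁.1, hpU⟩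
  have hm1 : 1 ≤ ‖m p‖ := one_le_norm_graphNormal A p
  have hd₁ := h𝒯.dist_le_of_isClosestPoint hN hx₁ hp₁
  have hd₂ := h𝒯.dist_le_of_isClosestPoint hN hx₂ hp₂
  have hgr : ∀ x ∈ 𝒯.boundary, dist x p ≤ h → x = graphPoint A φh (A x).fst := fun x hx hd => by
    have : x ∈ graphSet A 𝒜.α φh := hg ▸ ⟨hx, hball (by rw [Metric.mem_ball]; linarith)⟩
    exact coord_ext A (by simp) (by simpa using this.2)
  -- The segment between the base points of `x₁` and `x₂`, lifted to `Γ_h` by `φh`, is a path from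
  -- `x₁` to `x₂` on finitely many faces.
  set z : ℝ → Euc (N - 1) := fun t => (A x₁).fst + t • ((A x₂).fst - (A x₁).fst) with hz
  set γ : ℝ → Euc N := fun t => graphPoint A φh (z t) with hγ
  have hγ0 : γ 0 = x₁ := by simp [hγ, hz, ← hgr x₁ hx₁ hd₁]
  have hγ1 : γ 1 = x₂ := by simp [hγ, hz, ← hgr x₂ hx₂ hd₂]
  have hzp : ∀ t ∈ Icc (0 : ℝ) 1, ‖z t - (A p).fst‖ ≤ h := fun t ht => by
    have e : z t - (A p).fst = (1 - t) • ((A x₁).fst - (A p).fst) + t • ((A x₂).fst - (A p).fst) := by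
      simp only [hz]; module
    have h1 := (norm_fst_sub_le A x₁ p).trans hd₁
    have h2 := (norm_fst_sub_le A x₂ p).trans hd₂
    have h3 : 0 ≤ 1 - t := by linarith [ht.2]
    rw [e]
    calc _ ≤ (1 - t) * ‖(A x₁).fst - (A p).fst‖ + t * ‖(A x₂).fst - (A p).fst‖ := by
          refine (norm_add_le _ _).trans_eq ?_
          rw [norm_smul, norm_smul, Real.norm_of_nonneg h3, Real.norm_of_nonneg ht.1]
      _ ≤ (1 - t) * h + t * h := add_le_add (mul_le_mul_of_nonneg_left h1 h3)
          (mul_le_mul_of_nonneg_left h2 ht.1)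
      _ = h := by ring
  have hzR : ∀ t ∈ Icc (0 : ℝ) 1, ‖z t - (A p).fst‖ + h < R := fun t ht => by linarith [hzp t ht]
  have hzΔ : ∀ t ∈ Icc (0 : ℝ) 1, z t ∈ baseSet N 𝒜.α := fun t ht =>
    mem_baseSet_of_ball_subset hΩ hball (by linarith [hzp t ht])
  have hγc : ContinuousOn γ (Icc 0 1) := by
    have hzc : Continuous z := by fun_prop
    have h1 : ContinuousOn (fun t => (z t, φh (z t))) (Icc 0 1) :=
      hzc.continuousOn.prodMk (hc.comp hzc.continuousOn hzΔ)
    exact A.symm.continuous.comp_continuousOn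
      ((WithLp.prod_continuous_toLp 2 _ _).comp_continuousOn h1)
  have hγΓ : ∀ t ∈ Icc (0 : ℝ) 1, γ t ∈ 𝒯.boundary := fun t ht => by
    have : γ t ∈ 𝒯.boundary ∩ 𝒜.U r := by
      rw [hg]
      exact ⟨by rw [coord_graphPoint_fst]; exact hzΔ t ht, by simp [hγ]⟩
    exact this.1
  have hγp : ∀ t ∈ Icc (0 : ℝ) 1, dist (γ t) p ≤ (2 + 2 * B) * h := fun t ht => by
    have h1 := dist_le_add_coord A (γ t) p
    rw [coord_graphPoint_fst, coord_graphPoint_snd, hpg.2] at h1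
    have h2 := abs_sub_le_of_graph hN hΩ h𝒯 hc hg hh hB hball (hzR t ht)
    have h3 := abs_sub_le_of_mem_baseSet hB (hzΔ t ht) hpg.1
    have h4 : (B : ℝ) * ‖z t - (A p).fst‖ ≤ B * h := by gcongr; exact hzp t ht
    have h5 := abs_sub_le (φh (z t)) (φ (z t)) (φ (A p).fst)
    linarith [hzp t ht]
  have key := abs_sub_le_of_finite_closed_cover 𝒯.finite_boundaryMesh
    (F := fun S => Icc (0 : ℝ) 1 ∩ γ ⁻¹' simplexHull S)
    (fun S _ => hγc.preimage_isClosed_of_isClosed isClosed_Icc (isCompact_simplexHull S).isClosed)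
    (fun t ht => by
      obtain ⟨S, hS, htS⟩ := mem_iUnion₂.1 (hγΓ t ht)
      exact mem_iUnion₂.2 ⟨S, hS, ht, htS⟩)
    (g := fun t => inner ℝ (m p) (γ t)) (by fun_prop)
    (κ := 2 * (1 + B) * θ * ‖x₁ - x₂‖) (fun S hS s hs t ht => by
      have hF := h𝒯.isRegularFace hS
      have hSU := subset_U_of_graphPoint_mem hΩ h𝒯 hc hg hh hball (hzR s hs.2) hS hs.1.2
      obtain ⟨v, hv⟩ := hF.nonempty hN
      have hvd : dist p v ≤ (3 + 2 * B) * h := by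
        have h1 := dist_triangle_left p v (γ s)
        linarith [hγp s hs.2, hF.dist_le hs.1.2 (subset_simplexHull hv)]
      have h1 : |inner ℝ (m p) (γ s - γ t)| ≤ θ * ‖γ s - γ t‖ := by
        refine (hF.abs_inner_le hP (fun v hv => hSU (subset_simplexHull hv)) hv ⟨hp₁.1, hpU⟩
          hs.1.2 ht.1.2).trans ?_
        refine mul_le_mul_of_nonneg_right ?_ (norm_nonneg _)
        calc (L : ℝ) * (2 * σ * N * h + dist p v) ≤ L * (2 * |σ| * N * h + (3 + 2 * B) * h) := by
              have := le_abs_self σ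
              gcongr
          _ = θ := by rw [hθ]; ring
      have h2 := dist_le_add_coord A (γ s) (γ t)
      have h3 := inner_graphNormal A (φ := φ) p (γ s) (γ t)
      simp only [hγ, coord_graphPoint_fst, coord_graphPoint_snd] at h2 h3
      have h4 : |fderiv ℝ φ (A p).fst (z s - z t)| ≤ B * ‖z s - z t‖ :=
        (ContinuousLinearMap.le_opNorm _ _).trans
          (mul_le_mul_of_nonneg_right (hB _ hpg.1) (norm_nonneg _))
      have h5 : |φh (z s) - φh (z t)| ≤ θ * ‖γ s - γ t‖ + B * ‖z s - z t‖ := by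
        rw [show φh (z s) - φh (z t) = inner ℝ (m p) (γ s - γ t) +
          fderiv ℝ φ (A p).fst (z s - z t) by rw [h3]; ring]
        exact (abs_add_le _ _).trans (add_le_add h1 h4)
      -- The term `θ‖γ s - γ t‖` is absorbed on the left, since `θ ≤ 1/4`.
      have h6 : ‖γ s - γ t‖ ≤ 2 * (1 + B) * ‖z s - z t‖ := by
        rw [dist_eq_norm] at h2
        nlinarith [norm_nonneg (γ s - γ t), mul_nonneg (sub_nonneg.2 hθ1) (norm_nonneg (γ s - γ t))]
      have h7 : ‖z s - z t‖ ≤ |s - t| * ‖x₁ - x₂‖ := by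
        have e : z s - z t = (s - t) • ((A x₂).fst - (A x₁).fst) := by simp only [hz]; module
        rw [e, norm_smul, Real.norm_eq_abs, norm_sub_rev x₁, ← dist_eq_norm x₂]
        have := norm_fst_sub_le A x₂ x₁
        gcongr
      change |inner ℝ (m p) (γ s) - inner ℝ (m p) (γ t)| ≤ _
      rw [← inner_sub_right]
      calc _ ≤ θ * ‖γ s - γ t‖ := h1
        _ ≤ θ * (2 * (1 + B) * (|s - t| * ‖x₁ - x₂‖)) := by
          gcongr
          exact h6.trans (by gcongr)
        _ = _ := by ring)
  obtain ⟨s₁, hs₁⟩ := hP.normal p ⟨hp₁.1, hpU⟩ x₁ hp₁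
  obtain ⟨s₂, hs₂⟩ := hP.normal p ⟨hp₁.1, hpU⟩ x₂ hp₂
  -- Since `x₂ - x₁` is parallel to `m p` and `‖m p‖ ≥ 1`, the pairing with `m p` changes by at
  -- least `‖x₁ - x₂‖` between the endpoints, whereas `key` allows at most half of this.
  have e : x₂ - x₁ = (s₂ - s₁) • m p := by
    rw [sub_smul, ← hs₁, ← hs₂]; abel
  change |inner ℝ (m p) (γ 1) - inner ℝ (m p) (γ 0)| ≤ _ at key
  rw [hγ0, hγ1, ← inner_sub_right, norm_sub_rev, e, real_inner_smul_right,
    real_inner_self_eq_norm_sq, norm_smul, Real.norm_eq_abs, abs_mul, abs_sq] at key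
  by_contra hne
  have hpos : 0 < |s₂ - s₁| * ‖m p‖ := by
    rw [← Real.norm_eq_abs, ← norm_smul, ← e]
    exact norm_pos_iff.2 (sub_ne_zero.2 (Ne.symm hne))
  have : |s₂ - s₁| * ‖m p‖ ≤ |s₂ - s₁| * ‖m p‖ ^ 2 := by
    rw [sq, ← mul_assoc]; exact le_mul_of_one_le_right hpos.le hm1
  nlinarith [mul_le_mul_of_nonneg_right hhL hpos.le]

end Bijectivity

/-! ### Global estimates -/

theorem eventually_mul_lt (c : ℝ) {k : ℝ} (hk : 0 < k) : ∀ᶠ h in nhds (0 : ℝ), c * h < k := by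
  have : Filter.Tendsto (fun h : ℝ => c * h) (nhds 0) (nhds (c * 0)) :=
    (continuous_const.mul continuous_id).tendsto 0
  rw [mul_zero] at this
  exact this.eventually_lt_const hk

theorem eventually_mul_sq_lt (c : ℝ) {k : ℝ} (hk : 0 < k) :
    ∀ᶠ h in nhds (0 : ℝ), c * h ^ 2 < k := by
  have : Filter.Tendsto (fun h : ℝ => c * h ^ 2) (nhds 0) (nhds (c * 0 ^ 2)) :=
    (continuous_const.mul (continuous_id.pow 2)).tendsto 0
  rw [zero_pow two_ne_zero, mul_zero] at this
  exact this.eventually_lt_const hk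

section Global

variable {N : ℕ} {Ω : Set (Euc N)}

/-- For small `h`, the projection is well defined on regular faces of size `h` with vertices on the
boundary, and it changes their surface measure at most by the factor `1 + O(h²)`. -/
theorem exists_face_estimate (hN : 0 < N) (hΩ : IsC11Domain Ω) (σ : ℝ) :
    ∃ K : ℝ, 0 ≤ K ∧ ∀ᶠ h in nhds (0 : ℝ), 0 < h → ∀ S : Finset (Euc N),
      IsRegularFace (frontier Ω) σ h S →
        (∀ x ∈ simplexHull S, ∃! p, IsClosestPoint (frontier Ω) x p) ∧
        AlmostMeasurePreservingOn (surfaceMeasure N) (K * h ^ 2) (surfaceProj (frontier Ω))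
          (simplexHull S) := by
  -- Regular faces refer to no atlas, so any atlas of `Ω` serves here and `K` does not depend on the
  -- prescribed one.
  obtain ⟨𝒜⟩ := hΩ.exists_atlas
  obtain ⟨L, B, R, hR, hL, -, hcov⟩ := 𝒜.exists_constants hΩ
  have hb := biLipConst_nonneg N L σ
  refine ⟨2 ^ (N - 1) * 2 * biLipConst N L σ, by positivity, ?_⟩
  filter_upwards [eventually_mul_lt 2 hR, eventually_mul_sq_lt (2 * biLipConst N L σ) one_pos,
    eventually_mul_sq_lt (4 * L ^ 2) one_pos] with h h1 h2 h3 hh S hS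
  obtain ⟨v, hv⟩ := hS.nonempty hN
  obtain ⟨r, hr⟩ := hcov v (hS.vertices_mem v hv)
  have hP := 𝒜.isNormalPatch hΩ.isOpen (hL r)
  refine ⟨fun x hx => hS.existsUnique_isClosestPoint isClosed_frontier hP hv hr h1 hh
    (by linarith) hx, ?_⟩
  have := hS.almostMeasurePreservingOn isClosed_frontier hP hv hr h1 hh (by linarith)
  convert this using 1
  ring

/-- For small `h`, every point of the boundary is a closest point of exactly one point of the
discrete boundary. -/
theorem eventually_existsUnique_preimage (hN : 0 < N) (hΩ : IsC11Domain Ω) (σ : ℝ)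
    (𝒜 : C11Atlas Ω) : ∀ᶠ h in nhds (0 : ℝ), 0 < h → ∀ 𝒯 : Triangulation N,
      IsAdmissible 𝒜 σ h 𝒯 → ∀ p ∈ frontier Ω,
        ∃! x, x ∈ 𝒯.boundary ∧ IsClosestPoint (frontier Ω) x p := by
  obtain ⟨L, B, R, hR, hL, hB, hcov⟩ := 𝒜.exists_constants hΩ
  -- `ε` scales the length of the normal segments; it depends only on the constants of the atlas and
  -- is fixed before `h`.
  obtain ⟨ε, ⟨hε1, hε2⟩, hε⟩ : ∃ ε : ℝ, (4 * L * ε < 1 ∧ 2 * (1 + B) * ε < R) ∧ 0 < ε := by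
    have h1 := (eventually_mul_lt (4 * L) one_pos).and (eventually_mul_lt (2 * (1 + B)) hR)
    exact ((h1.filter_mono nhdsWithin_le_nhds).and
      (self_mem_nhdsWithin (a := (0 : ℝ)) (s := Ioi 0))).exists
  filter_upwards [eventually_mul_lt 2 hR, eventually_mul_lt (2 * (1 + B)) hε,
    eventually_mul_lt (4 * (1 + B) * (L * (2 * |σ| * N + (3 + 2 * B)))) one_pos]
    with h h1 h2 h3 hh 𝒯 h𝒯 p hp
  obtain ⟨r, hr⟩ := hcov p hp
  obtain ⟨x, hx, hxp⟩ := exists_mem_boundary_isClosestPoint hN hΩ.isOpen h𝒯 hh (hL r) (hB r) hp hr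
    hε (by linarith) (by linarith) h1 (by linarith)
  exact ⟨x, ⟨hx, hxp⟩, fun y hy => eq_of_isClosestPoint hN hΩ.isOpen h𝒯 hh (hL r) (hB r) hr h1
    (by linarith) hy.1 hx hy.2 hxp⟩

end Global

theorem mainTheorem7 (N : ℕ) (hN : 2 ≤ N) (Ω : Set (Euc N)) (hΩ : IsC11Domain Ω) (σ : ℝ) :
    ∃ C : ℝ, 0 < C ∧ ∀ 𝒜 : C11Atlas Ω, ∃ h₀ : ℝ, 0 < h₀ ∧
      ∀ h : ℝ, 0 < h → h ≤ h₀ → ∀ 𝒯 : Triangulation N, IsAdmissible 𝒜 σ h 𝒯 →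
        -- the projection is well defined on `Γ_h`
        (∀ x ∈ 𝒯.boundary, ∃! p, IsClosestPoint (frontier Ω) x p) ∧
        -- the estimate on each boundary face
        (∀ S ∈ 𝒯.boundaryMesh, ∀ f : Euc N → ℝ,
          IntegrableOn f (surfaceProj (frontier Ω) '' simplexHull S) (surfaceMeasure N) →
          IntegrableOn (f ∘ surfaceProj (frontier Ω)) (simplexHull S) (surfaceMeasure N) ∧
          |(∫ x in surfaceProj (frontier Ω) '' simplexHull S, f x ∂(surfaceMeasure N)) -
              ∫ x in simplexHull S, f (surfaceProj (frontier Ω) x) ∂(surfaceMeasure N)| ≤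
            C * h ^ 2 *
              ∫ x in surfaceProj (frontier Ω) '' simplexHull S, |f x| ∂(surfaceMeasure N)) ∧
        -- the estimates on the whole boundary
        (∀ f : Euc N → ℝ, IntegrableOn f (frontier Ω) (surfaceMeasure N) →
          IntegrableOn (f ∘ surfaceProj (frontier Ω)) 𝒯.boundary (surfaceMeasure N) ∧
          |(∫ x in frontier Ω, f x ∂(surfaceMeasure N)) -
              ∫ x in 𝒯.boundary, f (surfaceProj (frontier Ω) x) ∂(surfaceMeasure N)| ≤
            C * h ^ 2 * ∫ x in frontier Ω, |f x| ∂(surfaceMeasure N) ∧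
          |∫ x in 𝒯.boundary, f (surfaceProj (frontier Ω) x) ∂(surfaceMeasure N)| ≤
            C * ∫ x in frontier Ω, |f x| ∂(surfaceMeasure N)) ∧
        -- the `L^p` bound
        (∀ p : ℝ≥0∞, 1 ≤ p → ∀ f : Euc N → ℝ,
          MemLp f p ((surfaceMeasure N).restrict (frontier Ω)) →
          MemLp (f ∘ surfaceProj (frontier Ω)) p ((surfaceMeasure N).restrict 𝒯.boundary) ∧
          eLpNorm (f ∘ surfaceProj (frontier Ω)) p ((surfaceMeasure N).restrict 𝒯.boundary) ≤
            ENNReal.ofReal C ^ (1 / p).toReal *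
              eLpNorm f p ((surfaceMeasure N).restrict (frontier Ω))) := by
  obtain ⟨K, hK, hface⟩ := exists_face_estimate (by omega) hΩ σ
  -- `2K` serves the differences of integrals, where `2δ = 2Kh²`; the 2 serves the stability bounds,
  -- where `1 + δ ≤ 2` because `Kh² < 1`.
  refine ⟨2 * K + 2, by linarith, fun 𝒜 => ?_⟩
  have hev := (hface.and (eventually_existsUnique_preimage (by omega) hΩ σ 𝒜)).and
    (eventually_mul_sq_lt K one_pos)
  obtain ⟨h₀, hh₀, hball⟩ := Metric.eventually_nhds_iff.1 hev
  refine ⟨h₀ / 2, half_pos hh₀, fun h hh hle 𝒯 h𝒯 => ?_⟩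
  obtain ⟨⟨hf, hpre⟩, hKh⟩ := hball (y := h) (by
    rw [Real.dist_eq, sub_zero, abs_of_pos hh]; linarith)
  have hδ : 0 ≤ K * h ^ 2 := by positivity
  have hreg : ∀ S ∈ 𝒯.boundaryMesh, _ := fun S hS => hf hh S (h𝒯.isRegularFace hS)
  have huniq : ∀ x ∈ 𝒯.boundary, ∃! p, IsClosestPoint (frontier Ω) x p := fun x hx => by
    obtain ⟨S, hS, hxS⟩ := mem_iUnion₂.1 hx
    exact (hreg S hS).1 x hxS
  have hcp : ∀ x ∈ 𝒯.boundary, IsClosestPoint (frontier Ω) x (surfaceProj (frontier Ω) x) :=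
    fun x hx => surfaceProj_isClosestPoint (huniq x hx).exists
  have hinj : InjOn (surfaceProj (frontier Ω)) 𝒯.boundary := fun x hx y hy hxy =>
    (hpre hh 𝒯 h𝒯 _ (hcp x hx).1).unique ⟨hx, hcp x hx⟩ ⟨hy, hxy ▸ hcp y hy⟩
  have himage : surfaceProj (frontier Ω) '' 𝒯.boundary = frontier Ω := by
    refine Subset.antisymm (image_subset_iff.2 fun x hx => (hcp x hx).1) fun p hp => ?_
    obtain ⟨x, ⟨hx, hxp⟩, -⟩ := hpre hh 𝒯 h𝒯 p hp
    exact ⟨x, hx, (huniq x hx).unique (hcp x hx) hxp⟩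
  have hglobal : AlmostMeasurePreservingOn (surfaceMeasure N) (K * h ^ 2)
      (surfaceProj (frontier Ω)) 𝒯.boundary :=
    AlmostMeasurePreservingOn.biUnion 𝒯.finite_boundaryMesh
      (fun S _ => (isCompact_simplexHull S).isClosed) (fun S hS => (hreg S hS).2) hinj
  have hint : ∀ (Z : Set (Euc N)) (f : Euc N → ℝ), 0 ≤ ∫ x in Z, |f x| ∂(surfaceMeasure N) :=
    fun Z f => integral_nonneg fun x => abs_nonneg _
  have hC : 2 * (K * h ^ 2) ≤ (2 * K + 2) * h ^ 2 := by linarith [sq_nonneg h]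
  refine ⟨huniq, fun S hS f hfS => ?_, fun f hfΓ => ?_, fun p _ f hfp => ?_⟩
  · obtain ⟨a, b, -⟩ := (hreg S hS).2.integral_estimates hδ hfS
    exact ⟨a, b.trans (mul_le_mul_of_nonneg_right hC (hint _ _))⟩
  · rw [← himage] at hfΓ
    obtain ⟨a, b, c⟩ := hglobal.integral_estimates hδ hfΓ
    rw [himage] at b c
    exact ⟨a, b.trans (mul_le_mul_of_nonneg_right hC (hint _ _)),
      c.trans (mul_le_mul_of_nonneg_right (by linarith) (hint _ _))⟩
  · rw [← himage] at hfp
    obtain ⟨a, b⟩ := hglobal.memLp_comp hδ hfp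
    rw [himage] at b
    refine ⟨a, b.trans ?_⟩
    exact mul_le_mul_left (ENNReal.rpow_le_rpow (ENNReal.ofReal_le_ofReal (by linarith))
      ENNReal.toReal_nonneg) _
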